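/- Let $E^4_1=\mathbb{R}^4$ be the oriented Minkowski 4-space with metric $h(x,y)=x^1y^1+x^2y^2+x^3y^3-x^4y^4$, and let $\hat h$ be the induced metric on $\bigwedge^2E^4_1$, $\hat h(x\wedge y,u\wedge v)=h(x,u)h(y,v)-h(x,v)h(y,u)$, of signature $(3,3)$. For a linear map $P$ of $E^4_1$ let $\tilde T_P$ be the linear map of $\bigwedge^2E^4_1$ with $\tilde T_P(x\wedge y)=Px\wedge Py$. Let $(e_1,e_2,e_3,e_4)$ be an ordered pseudo-orthonormal basis of $E^4_1$ giving the orientation, with $e_1,e_2,e_3$ space-like and $e_4$ time-like, and put $\omega_{ij}=e_i\wedge e_j$. For $\phi\in[0,\pi]$ let $$\Omega=\sqrt2\,(\cos\phi\,\omega_{12}+\sin\phi\,\omega_{23}+\omega_{34}),\qquad \mathcal L(\Omega)=\{\tilde T_P(\Omega)\mid P\in SO(3,1)\}.$$ For $\theta,t\in\mathbb{R}$ let $P_{2,1}=P_{2,1}(\theta)$ and $P_{2,2}=P_{2,2}(t)$ be the elements of $SO(3,1)$ given by $$P_{2,1}e_1=\cos\theta\, e_1+\sin\theta\, e_3,\quad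 P_{2,1}e_3=-\sin\theta\, e_1+\cos\theta\, e_3,\quad P_{2,1}e_2=e_2,\quad P_{2,1}e_4=e_4,$$ $$P_{2,2}e_2=\cosh t\, e_2+\sinh t\, e_4,\quad P_{2,2}e_4=\sinh t\, e_2+\cosh t\, e_4,\quad P_{2,2}e_1=e_1,\quad P_{2,2}e_3=e_3,$$ and set $\mathcal S=\{\tilde T_{P_{2,1}}\tilde T_{P_{2,2}}(\Omega)\mid \theta,t\in\mathbb{R}\}$. Put $$E_{\pm,1}=\tfrac1{\sqrt2}(\omega_{12}\pm\omega_{34}),\quad E_{\pm,2}=\tfrac1{\sqrt2}(\omega_{13}\pm\omega_{42}),\quad E_{\pm,3}=\tfrac1{\sqrt2}(\omega_{14}\pm\omega_{23}),$$ $$X_\pm=\sin\phi\,E_{\pm,1}\mp\cos\phi\,E_{\pm,3}-E_{\mp,3},\qquad Y_\pm=E_{\pm,2}.$$ Suppose $\phi\ne\pi/2$. Then: (1) $\mathcal L(\Omega)$ is a $4$-dimensional submanifold of $\bigwedge^2E^4_1$ on which the induced metric $\hat h^\top$ is non-degenerate, and $\mathcal S\subset\mathcal L(\Omega)$ is a time-like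 surface, that is, a two-dimensional submanifold on which the induced metric has signature $(1,1)$. (2) There are well-defined vector fields $\tilde X_\pm$, $\tilde Y_\pm$ of $\mathcal L(\Omega)$ along $\mathcal S$ whose values at the point $\tilde T_{P_{2,1}}\tilde T_{P_{2,2}}(\Omega)$ are $\tilde T_{P_{2,1}}\tilde T_{P_{2,2}}(X_\pm)$ and $\tilde T_{P_{2,1}}\tilde T_{P_{2,2}}(Y_\pm)$ for all $\theta,t$, and they are parallel along $\mathcal S$ in $\mathcal L(\Omega)$: their covariant derivatives with respect to the Levi-Civita connection $\hat\nabla^\top$ of $\hat h^\top$ vanish in all directions tangent to $\mathcal S$. -/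

import Mathlib

open scoped ContDiff Topology

/-! ### Minkowski space, its exterior square, and the action of `SO(3,1)` -/

/-- The Minkowski 4-space (as a vector space); `x 0, x 1, x 2, x 3` are the four coordinates. -/
abbrev E41 : Type := Fin 4 → ℝ

/-- The diagonal matrix `diag(1, 1, 1, -1)`. -/
def minkowskiMatrix : Matrix (Fin 4) (Fin 4) ℝ := Matrix.diagonal ![1, 1, 1, -1]

/-- The Minkowski metric `h(x, y) = x¹y¹ + x²y² + x³y³ - x⁴y⁴`. -/
noncomputable def minkowski : LinearMap.BilinForm ℝ E41 := Matrix.toBilin' minkowskiMatrix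

theorem minkowski_apply (x y : E41) :
    minkowski x y = x 0 * y 0 + x 1 * y 1 + x 2 * y 2 - x 3 * y 3 := by
  simp [minkowski, minkowskiMatrix, Matrix.toBilin'_apply', Matrix.mulVec_diagonal,
    dotProduct, Fin.sum_univ_four]
  ring

/-- The 2-fold exterior power of Minkowski 4-space. -/
abbrev Bivector : Type := ⋀[ℝ]^2 E41

/-- The coordinates of a bivector in some linear basis. -/
noncomputable def bivectorCoord : Bivector ≃ₗ[ℝ] (Fin (Module.finrank ℝ Bivector) → ℝ) :=
  (Module.finBasis ℝ Bivector).equivFun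

/-- An auxiliary norm. `Bivector` is finite-dimensional, so all norms give the same topology and
the same derivatives; the norm is used for nothing else. -/
noncomputable instance : NormedAddCommGroup Bivector :=
  NormedAddCommGroup.induced Bivector (Fin (Module.finrank ℝ Bivector) → ℝ) bivectorCoord
    bivectorCoord.injective

noncomputable instance : NormedSpace ℝ Bivector :=
  NormedSpace.induced ℝ Bivector (Fin (Module.finrank ℝ Bivector) → ℝ) bivectorCoord

/-- The bivector `x ∧ y`. -/
noncomputable def wedge (x y : E41) : Bivector := exteriorPower.ιMulti ℝ 2 ![x, y]

/-- The metric on bivectors induced by the Minkowski metric. -/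
noncomputable def bivectorMetric : LinearMap.BilinForm ℝ Bivector :=
  exteriorPower.pairingDual ℝ E41 2 ∘ₗ exteriorPower.map 2 minkowski

theorem bivectorMetric_wedge (x y u v : E41) :
    bivectorMetric (wedge x y) (wedge u v) =
      minkowski x u * minkowski y v - minkowski x v * minkowski y u := by
  simp only [bivectorMetric, wedge, LinearMap.comp_apply, exteriorPower.map_apply_ιMulti,
    exteriorPower.pairingDual_ιMulti_ιMulti, Matrix.det_fin_two]
  simp
  ring

/-- The group `SO(3,1)`, as a set of linear endomorphisms of Minkowski space. -/
def SO31 : Set (E41 →ₗ[ℝ] E41) :=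
  {P | (∀ x y, minkowski (P x) (P y) = minkowski x y) ∧ LinearMap.det P = 1}

/-- The linear transformation of bivectors induced by `P`: `x ∧ y ↦ P x ∧ P y`. -/
noncomputable def bivectorMap (P : E41 →ₗ[ℝ] E41) : Bivector →ₗ[ℝ] Bivector :=
  exteriorPower.map 2 P

theorem bivectorMap_wedge (P : E41 →ₗ[ℝ] E41) (x y : E41) :
    bivectorMap P (wedge x y) = wedge (P x) (P y) := by
  simp only [bivectorMap, wedge, exteriorPower.map_apply_ιMulti]
  congr 1
  ext i j
  fin_cases i <;> rfl

/-- The `SO(3,1)`-orbit through a bivector. -/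
def so31Orbit (Ω : Bivector) : Set Bivector := {Ψ | ∃ P ∈ SO31, Ψ = bivectorMap P Ω}

/-- The ordered pseudo-orthonormal bases of Minkowski space (the first three vectors space-like,
the fourth one time-like) which give the standard orientation. -/
def IsOrientedPseudoOrthonormal (e : Module.Basis (Fin 4) ℝ E41) : Prop :=
  (∀ i j, minkowski (e i) (e j) = minkowskiMatrix i j) ∧ 0 < (Pi.basisFun ℝ (Fin 4)).det e

/-- The rotation by the angle `θ` in the plane of `e₁, e₃`. -/
noncomputable def P21 (e : Module.Basis (Fin 4) ℝ E41) (θ : ℝ) : E41 →ₗ[ℝ] E41 :=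
  Matrix.toLin e e
    !![Real.cos θ, 0, -Real.sin θ, 0;
       0, 1, 0, 0;
       Real.sin θ, 0, Real.cos θ, 0;
       0, 0, 0, 1]

/-- The boost with parameter `t` in the plane of `e₂, e₄`. -/
noncomputable def P22 (e : Module.Basis (Fin 4) ℝ E41) (t : ℝ) : E41 →ₗ[ℝ] E41 :=
  Matrix.toLin e e
    !![1, 0, 0, 0;
       0, Real.cosh t, 0, Real.sinh t;
       0, 0, 1, 0;
       0, Real.sinh t, 0, Real.cosh t]

/-- The composition of the actions of `P21 e θ` and `P22 e t` on bivectors. -/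
noncomputable def T2 (e : Module.Basis (Fin 4) ℝ E41) (θ t : ℝ) : Bivector →ₗ[ℝ] Bivector :=
  bivectorMap (P21 e θ) ∘ₗ bivectorMap (P22 e t)

/-- `Ω = √2 (cos φ e₁∧e₂ + sin φ e₂∧e₃ + e₃∧e₄)`. -/
noncomputable def Omega (e : Module.Basis (Fin 4) ℝ E41) (φ : ℝ) : Bivector :=
  √2 • (Real.cos φ • wedge (e 0) (e 1) + Real.sin φ • wedge (e 1) (e 2) + wedge (e 2) (e 3))

/-- `E_{ε,1} = (e₁∧e₂ + ε e₃∧e₄)/√2`, for a sign `ε = ±1`. -/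
noncomputable def E1 (e : Module.Basis (Fin 4) ℝ E41) (ε : ℝ) : Bivector :=
  (1 / √2) • (wedge (e 0) (e 1) + ε • wedge (e 2) (e 3))

/-- `E_{ε,2} = (e₁∧e₃ + ε e₄∧e₂)/√2`, for a sign `ε = ±1`. -/
noncomputable def E2 (e : Module.Basis (Fin 4) ℝ E41) (ε : ℝ) : Bivector :=
  (1 / √2) • (wedge (e 0) (e 2) + ε • wedge (e 3) (e 1))

/-- `E_{ε,3} = (e₁∧e₄ + ε e₂∧e₃)/√2`, for a sign `ε = ±1`. -/
noncomputable def E3 (e : Module.Basis (Fin 4) ℝ E41) (ε : ℝ) : Bivector :=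
  (1 / √2) • (wedge (e 0) (e 3) + ε • wedge (e 1) (e 2))

/-- `X_ε = sin φ E_{ε,1} - ε cos φ E_{ε,3} - E_{-ε,3}`, for a sign `ε = ±1`. -/
noncomputable def Xvec (e : Module.Basis (Fin 4) ℝ E41) (φ ε : ℝ) : Bivector :=
  Real.sin φ • E1 e ε - (ε * Real.cos φ) • E3 e ε - E3 e (-ε)

/-- `Y_ε = E_{ε,2}`, for a sign `ε = ±1`. -/
noncomputable def Yvec (e : Module.Basis (Fin 4) ℝ E41) (ε : ℝ) : Bivector := E2 e ε

/-- The surface `{T_{P21} ∘ T_{P22} (Ω) | θ, t ∈ ℝ}`. -/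
def surfaceS (e : Module.Basis (Fin 4) ℝ E41) (φ : ℝ) : Set Bivector :=
  {p | ∃ θ t : ℝ, p = T2 e θ t (Omega e φ)}

/-! ### Submanifolds of a pseudo-Euclidean vector space and their Levi-Civita connection -/

section Geometry

variable {V : Type*} [NormedAddCommGroup V] [NormedSpace ℝ V]

/-- `ψ`, on the open set `U ⊆ ℝᵏ`, is a local parametrization of `M` (the inverse of a chart):
a smooth immersion that is a homeomorphism onto a relatively open subset of `M`. -/
structure IsLocalParam {k : ℕ} (M : Set V) (U : Set (Fin k → ℝ)) (ψ : (Fin k → ℝ) → V) :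
    Prop where
  isOpen : IsOpen U
  smooth : ContDiffOn ℝ ∞ ψ U
  immersion : ∀ u ∈ U, Function.Injective (fderiv ℝ ψ u)
  embedding : Topology.IsEmbedding (U.domRestrict ψ)
  image : ∃ O : Set V, IsOpen O ∧ ψ '' U = M ∩ O

/-- `M` is a `k`-dimensional (embedded, smooth) submanifold. -/
def IsSubmanifold (k : ℕ) (M : Set V) : Prop :=
  ∀ p ∈ M, ∃ (U : Set (Fin k → ℝ)) (ψ : (Fin k → ℝ) → V), IsLocalParam M U ψ ∧ p ∈ ψ '' U

/-- `γ` is, near the parameter `s`, a smooth curve in `M`. -/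
def IsCurveIn (M : Set V) (γ : ℝ → V) (s : ℝ) : Prop :=
  ContDiffAt ℝ ∞ γ s ∧ ∀ᶠ r in 𝓝 s, γ r ∈ M

/-- The tangent space of `M` at `p`: the velocities at `p` of the smooth curves in `M`. -/
def tangentVectors (M : Set V) (p : V) : Set V :=
  {v | ∃ γ : ℝ → V, IsCurveIn M γ 0 ∧ γ 0 = p ∧ deriv γ 0 = v}

/-- The `i`-th coordinate vector field of a parametrization. -/
noncomputable def coordField {k : ℕ} (ψ : (Fin k → ℝ) → V) (i : Fin k) (u : Fin k → ℝ) : V :=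
  fderiv ℝ ψ u (Pi.single i 1)

/-- The components `g_{ij}` of the metric induced by the ambient metric `B`. -/
noncomputable def inducedMetric (B : LinearMap.BilinForm ℝ V) {k : ℕ} (ψ : (Fin k → ℝ) → V)
    (u : Fin k → ℝ) : Matrix (Fin k) (Fin k) ℝ :=
  Matrix.of fun i j => B (coordField ψ i u) (coordField ψ j u)

/-- The partial derivative `∂_l g_{ij}`. -/
noncomputable def metricPartial (B : LinearMap.BilinForm ℝ V) {k : ℕ} (ψ : (Fin k → ℝ) → V)
    (l i j : Fin k) (u : Fin k → ℝ) : ℝ :=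
  fderiv ℝ (fun w => inducedMetric B ψ w i j) u (Pi.single l 1)

/-- The Christoffel symbols of the Levi-Civita connection of the induced metric:
`Γ^m_{ij} = ½ ∑_l g^{ml} (∂_i g_{jl} + ∂_j g_{il} - ∂_l g_{ij})`. -/
noncomputable def christoffel (B : LinearMap.BilinForm ℝ V) {k : ℕ} (ψ : (Fin k → ℝ) → V)
    (m i j : Fin k) (u : Fin k → ℝ) : ℝ :=
  (1 / 2) * ∑ l, (inducedMetric B ψ u)⁻¹ m l *
    (metricPartial B ψ i j l u + metricPartial B ψ j i l u - metricPartial B ψ l i j u)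

/-- `M` is a `k`-dimensional submanifold on which the metric induced by `B` is non-degenerate, so
that the induced metric has a Levi-Civita connection. -/
def IsPseudoRiemannianSubmanifold (B : LinearMap.BilinForm ℝ V) (k : ℕ) (M : Set V) : Prop :=
  IsSubmanifold k M ∧
    ∀ (U : Set (Fin k → ℝ)) (ψ : (Fin k → ℝ) → V), IsLocalParam M U ψ →
      ∀ u ∈ U, IsUnit (inducedMetric B ψ u).det

/-- `S` is a time-like surface: a 2-dimensional submanifold on each tangent plane of which `B` has
signature `(1,1)`. -/
def IsTimelikeSurface (B : LinearMap.BilinForm ℝ V) (S : Set V) : Prop :=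
  IsSubmanifold 2 S ∧
    ∀ p ∈ S, ∃ v w : V, tangentVectors S p = (Submodule.span ℝ {v, w} : Set V) ∧
      B v v = 1 ∧ B w w = -1 ∧ B v w = 0

/-- `D` is the covariant derivative at the parameter `s`, with respect to the Levi-Civita
connection of the metric of the `k`-dimensional submanifold `M` induced by `B`, of the vector field
`W` along the curve `γ` in `M`. In the coordinates of any local parametrization `ψ` of `M` around
`γ s`, with `γ = ψ ∘ x` and `W = ∑ v^m ∂_m` (so `W` is tangent to `M`), it is given by
`D^m = (v^m)' + ∑_{i,j} Γ^m_{ij} (x^i)' v^j`. -/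
def HasCovDerivAlong (B : LinearMap.BilinForm ℝ V) (k : ℕ) (M : Set V) (γ W : ℝ → V) (s : ℝ)
    (D : V) : Prop :=
  ∀ (U : Set (Fin k → ℝ)) (ψ : (Fin k → ℝ) → V), IsLocalParam M U ψ → γ s ∈ ψ '' U →
    ∃ x v : ℝ → Fin k → ℝ, DifferentiableAt ℝ x s ∧ DifferentiableAt ℝ v s ∧
      (∀ᶠ r in 𝓝 s, x r ∈ U ∧ γ r = ψ (x r) ∧ W r = ∑ m, v r m • coordField ψ m (x r)) ∧
      D = ∑ m, (deriv v s m +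
        ∑ i, ∑ j, christoffel B ψ m i j (x s) * deriv x s i * v s j) • coordField ψ m (x s)

/-- The vector field `W` along `S`, tangent to the `k`-dimensional submanifold `M ⊇ S`, is parallel
along `S` in `M`: its covariant derivative in `M` vanishes in every direction tangent to `S`,
i.e. along every smooth curve in `S`. -/
def IsParallelAlong (B : LinearMap.BilinForm ℝ V) (k : ℕ) (M S : Set V) (W : V → V) : Prop :=
  ∀ (γ : ℝ → V) (s : ℝ), IsCurveIn S γ s → HasCovDerivAlong B k M γ (fun r => W (γ r)) s 0

end Geometry

/-!
The idea is to identify bivectors with `ℂ³`. In the Plücker coordinates of the basis `e`, put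
`z₀ = p₀₁ + i p₂₃`, `z₁ = p₀₂ + i p₃₁`, `z₂ = p₁₂ + i p₀₃` (`complexCoord`). The metric on bivectors
is then the real part of the symmetric form `q = z₀² + z₁² + z₂²`, and its imaginary part is the
pairing `⋀² × ⋀² → ⋀⁴`, so that `SO(3,1)` preserves `q` (`complexForm_bivectorMap`). One has
`q(Ω) = 4 i cos φ`, and `φ ≠ π/2` says that `Ω` is not isotropic.

*The orbit.* It lies in the quadric `q = q(Ω)`. Conversely, if `p` is in this quadric and
`q(p + Ω) ≠ 0`, then the half-turn of `ℂ³` about `p + Ω` maps `Ω` to `p`; it is induced by the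
normalized energy-momentum tensor of the bivector `p + Ω`, which is a Lorentz transformation by the
Rainich identity (`mem_so31Orbit_of_complexForm_eq`). Hence near `Ω` the orbit is the quadric, which
is the graph of a branch of `z₀ = √(q(Ω) - z₁² - z₂²)`, and homogeneity takes care of the other
points. Its tangent space at `p` is the complex orthogonal complement of `p`, on which the metric is
non-degenerate because `p` is not isotropic.

*The surface.* The product of the rotation by `θ` and the boost by `t` is the rotation of `ℂ³` by the
complex angle `θ - i t` about the axis `z₁` (`complexCoord_T2`). Since the complex sine and cosine
parametrize the whole conic `c² + s² = 1`, the surface is the conic in which `z₁ = 0` meets the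
quadric (`mem_surfaceS_iff`). Its tangent plane at `p = (z₀, 0, z₂)` is the complex line spanned by
`τ = (z₂, 0, -z₀)`, and `κ τ` has the square `Re (κ² q(Ω))`, a form of signature `(1,1)`.

*The parallel fields.* A tangent field is parallel along a curve if its derivative in the ambient
space is orthogonal to the tangent space of the orbit (`hasCovDerivAlong_zero`), because the
Christoffel symbols are the components of the tangential parts of the second derivatives of a
parametrization. The field with values `X_ε` is `p ↦ κ (z₂, 0, -z₀)` with `κ = (1 + ε i) / 2`, a
linear map which sends tangent vectors of the surface at `p` to complex multiples of `p`, and these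
are orthogonal to the orbit. The field with values `Y_ε` is constant.
-/

/-! ### Local parametrizations, curves and parallel fields -/

section Geometry

variable {V : Type*} [NormedAddCommGroup V] [NormedSpace ℝ V]

theorem IsLocalParam.contDiffAt {k : ℕ} {M : Set V} {U : Set (Fin k → ℝ)}
    {ψ : (Fin k → ℝ) → V} (h : IsLocalParam M U ψ) {u : Fin k → ℝ} (hu : u ∈ U) :
    ContDiffAt ℝ ∞ ψ u :=
  h.smooth.contDiffAt (h.isOpen.mem_nhds hu)

theorem IsLocalParam.mem {k : ℕ} {M : Set V} {U : Set (Fin k → ℝ)}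
    {ψ : (Fin k → ℝ) → V} (h : IsLocalParam M U ψ) {u : Fin k → ℝ} (hu : u ∈ U) : ψ u ∈ M := by
  obtain ⟨O, -, hO⟩ := h.image
  exact (hO.subset (Set.mem_image_of_mem ψ hu)).1

theorem fderiv_apply_eq_sum_coordField {k : ℕ} (ψ : (Fin k → ℝ) → V) (u w : Fin k → ℝ) :
    fderiv ℝ ψ u w = ∑ m, w m • coordField ψ m u := by
  conv_lhs => rw [pi_eq_sum_univ' w]
  simp [coordField, map_sum]

/-- Near a point of `ψ '' U`, a point of `M` has a parameter that is close to the given one. -/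
theorem IsLocalParam.eventually_exists {k : ℕ} {M : Set V} {U : Set (Fin k → ℝ)}
    {ψ : (Fin k → ℝ) → V} (h : IsLocalParam M U ψ) {u₀ : Fin k → ℝ} (hu₀ : u₀ ∈ U)
    {N : Set (Fin k → ℝ)} (hN : N ∈ 𝓝 u₀) :
    ∀ᶠ p in 𝓝 (ψ u₀), p ∈ M → ∃ u ∈ U, u ∈ N ∧ ψ u = p := by
  obtain ⟨O, hO, hOim⟩ := h.image
  have h1 : (Subtype.val ⁻¹' N : Set U) ∈ 𝓝 (⟨u₀, hu₀⟩ : U) :=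
    continuous_subtype_val.continuousAt.preimage_mem_nhds hN
  rw [h.embedding.isInducing.nhds_eq_comap, Filter.mem_comap] at h1
  obtain ⟨t, ht, htN⟩ := h1
  have h2 : O ∈ 𝓝 (ψ u₀) :=
    hO.mem_nhds (hOim.subset (Set.mem_image_of_mem ψ hu₀)).2
  filter_upwards [ht, h2] with p hpt hpO hpM
  obtain ⟨u, hu, rfl⟩ := hOim.superset ⟨hpM, hpO⟩
  exact ⟨u, hu, @htN ⟨u, hu⟩ hpt, rfl⟩

theorem IsLocalParam.exists_leftInverse [FiniteDimensional ℝ V] {k : ℕ} {M : Set V}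
    {U : Set (Fin k → ℝ)} {ψ : (Fin k → ℝ) → V} (h : IsLocalParam M U ψ) {u : Fin k → ℝ}
    (hu : u ∈ U) :
    ∃ L : V →L[ℝ] (Fin k → ℝ), L.comp (fderiv ℝ ψ u) = ContinuousLinearMap.id ℝ _ := by
  obtain ⟨g, hg⟩ := LinearMap.exists_leftInverse_of_injective (fderiv ℝ ψ u).toLinearMap
    (LinearMap.ker_eq_bot.mpr (h.immersion u hu))
  refine ⟨LinearMap.toContinuousLinearMap g, ?_⟩
  ext1 x
  exact LinearMap.congr_fun hg x

/-- A smooth curve in `M` has differentiable coordinates in every local parametrization of `M`: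
composing with a linear left inverse `L` of the differential of the parametrization reduces this
to the inverse function theorem. -/
theorem IsLocalParam.exists_coordinates_of_curve [FiniteDimensional ℝ V] {k : ℕ} {M : Set V}
    {U : Set (Fin k → ℝ)} {ψ : (Fin k → ℝ) → V} (h : IsLocalParam M U ψ) {γ : ℝ → V} {s : ℝ}
    (hγ : IsCurveIn M γ s) (hs : γ s ∈ ψ '' U) :
    ∃ x : ℝ → Fin k → ℝ, DifferentiableAt ℝ x s ∧ ∀ᶠ r in 𝓝 s, x r ∈ U ∧ γ r = ψ (x r) := by
  obtain ⟨u₀, hu₀, hψs⟩ := hs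
  obtain ⟨L, hL⟩ := h.exists_leftInverse hu₀
  have hψ := h.contDiffAt hu₀
  have hF : HasStrictFDerivAt (fun u => L (ψ u))
      ((ContinuousLinearEquiv.refl ℝ (Fin k → ℝ) : (Fin k → ℝ) →L[ℝ] (Fin k → ℝ))) u₀ := by
    have h1 := L.hasStrictFDerivAt.comp u₀ (hψ.hasStrictFDerivAt (by simp))
    rw [hL] at h1
    exact h1
  set g := hF.localInverse _ _ _ with hg
  have hgd : DifferentiableAt ℝ g (L (γ s)) := by
    rw [← hψs]
    exact hF.to_localInverse.differentiableAt
  have hγd : DifferentiableAt ℝ γ s := hγ.1.differentiableAt (by simp)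
  refine ⟨fun r => g (L (γ r)), ?_, ?_⟩
  · exact hgd.comp s (f := fun r => L (γ r)) (L.differentiableAt.comp s hγd)
  · have h3 := h.eventually_exists hu₀ hF.eventually_left_inverse
    rw [hψs] at h3
    filter_upwards [hγd.continuousAt.eventually h3, hγ.2] with r hr hrM
    obtain ⟨u, hu, huN, hur⟩ := hr hrM
    have h4 : g (L (γ r)) = u := by rw [← hur]; exact huN
    rw [h4]
    exact ⟨hu, hur.symm⟩

theorem IsLocalParam.differentiableAt_fderiv {k : ℕ} {M : Set V} {U : Set (Fin k → ℝ)}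
    {ψ : (Fin k → ℝ) → V} (h : IsLocalParam M U ψ) {u : Fin k → ℝ} (hu : u ∈ U) :
    DifferentiableAt ℝ (fderiv ℝ ψ) u :=
  ((h.contDiffAt hu).fderiv_right (m := 1) (by norm_cast)).differentiableAt (by simp)

/-- A differentiable tangent field along a curve has differentiable components with respect to the
coordinate fields. -/
theorem IsLocalParam.exists_components_of_field [FiniteDimensional ℝ V] {k : ℕ} {M : Set V}
    {U : Set (Fin k → ℝ)} {ψ : (Fin k → ℝ) → V} (h : IsLocalParam M U ψ) {x : ℝ → Fin k → ℝ}
    {W : ℝ → V} {s : ℝ} (hx : DifferentiableAt ℝ x s) (hxs : x s ∈ U)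
    (hW : DifferentiableAt ℝ W s) (hT : ∀ᶠ r in 𝓝 s, W r ∈ Set.range (fderiv ℝ ψ (x r))) :
    ∃ v : ℝ → Fin k → ℝ, DifferentiableAt ℝ v s ∧
      ∀ᶠ r in 𝓝 s, W r = fderiv ℝ ψ (x r) (v r) := by
  obtain ⟨L, hL⟩ := h.exists_leftInverse hxs
  have hA : DifferentiableAt ℝ (fun r => L.comp (fderiv ℝ ψ (x r))) s :=
    (differentiableAt_const L).clm_comp ((h.differentiableAt_fderiv hxs).comp s hx)
  have hinv : ContDiffAt ℝ 1 (ContinuousLinearMap.inverse : ((Fin k → ℝ) →L[ℝ] (Fin k → ℝ)) → _)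
      (L.comp (fderiv ℝ ψ (x s))) := by
    rw [hL]
    exact contDiffAt_map_inverse (ContinuousLinearEquiv.refl ℝ (Fin k → ℝ))
  refine ⟨fun r => (L.comp (fderiv ℝ ψ (x r))).inverse (L (W r)), ?_, ?_⟩
  · exact ((hinv.differentiableAt (by simp)).comp s hA).clm_apply (L.differentiableAt.comp s hW)
  · have hnhds : Set.range ((↑) : ((Fin k → ℝ) ≃L[ℝ] (Fin k → ℝ)) → _) ∈
        𝓝 (L.comp (fderiv ℝ ψ (x s))) := by
      rw [hL]
      exact ContinuousLinearEquiv.nhds (ContinuousLinearEquiv.refl ℝ (Fin k → ℝ))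
    filter_upwards [hT, hA.continuousAt.preimage_mem_nhds hnhds] with r ⟨w, hw⟩ ⟨E, hE⟩
    have h1 : L (W r) = E w := by
      rw [← hw]
      exact (DFunLike.congr_fun hE w).symm
    rw [← show (E : (Fin k → ℝ) →L[ℝ] (Fin k → ℝ)) = L.comp (fderiv ℝ ψ (x r)) from hE,
      ContinuousLinearMap.inverse_equiv, h1, ContinuousLinearEquiv.coe_coe,
      ContinuousLinearEquiv.symm_apply_apply, hw]

section Christoffel

variable {B : LinearMap.BilinForm ℝ V} {k : ℕ} {M : Set V}
  {U : Set (Fin k → ℝ)} {ψ : (Fin k → ℝ) → V} {u : Fin k → ℝ}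

theorem HasFDerivAt.bilinear [FiniteDimensional ℝ V] {E F : Type*} [NormedAddCommGroup E]
    [NormedSpace ℝ E] [NormedAddCommGroup F] [NormedSpace ℝ F] (B : V →ₗ[ℝ] V →ₗ[ℝ] F)
    {f g : E → V} {f' g' : E →L[ℝ] V} {x : E} (hf : HasFDerivAt f f' x) (hg : HasFDerivAt g g' x)
    (w : E) : fderiv ℝ (fun y => B (f y) (g y)) x w = B (f' w) (g x) + B (f x) (g' w) := by
  have h := (LinearMap.toContinuousBilinearMap B).hasFDerivAt_of_bilinear hf hg
  have h' : HasFDerivAt (fun y => B (f y) (g y)) _ x := h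
  rw [h'.fderiv]
  simp [add_comm]

theorem IsLocalParam.hasFDerivAt_coordField (h : IsLocalParam M U ψ) (hu : u ∈ U) (i : Fin k) :
    HasFDerivAt (coordField ψ i) ((fderiv ℝ (fderiv ℝ ψ) u).flip (Pi.single i 1)) u := by
  have := (h.differentiableAt_fderiv hu).hasFDerivAt.clm_apply
    (hasFDerivAt_const (Pi.single i (1 : ℝ)) u)
  rwa [ContinuousLinearMap.comp_zero, zero_add] at this

theorem IsLocalParam.metricPartial_eq [FiniteDimensional ℝ V] (h : IsLocalParam M U ψ) (hu : u ∈ U)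
    (l i j : Fin k) :
    metricPartial B ψ l i j u =
      B (fderiv ℝ (fderiv ℝ ψ) u (Pi.single l 1) (Pi.single i 1)) (coordField ψ j u) +
      B (coordField ψ i u) (fderiv ℝ (fderiv ℝ ψ) u (Pi.single l 1) (Pi.single j 1)) := by
  have := HasFDerivAt.bilinear B (h.hasFDerivAt_coordField hu i) (h.hasFDerivAt_coordField hu j)
    (Pi.single l 1)
  simpa [metricPartial, inducedMetric] using this

/-- The Christoffel symbols are the components of the tangential parts of the second partial
derivatives of the parametrization. -/
theorem IsLocalParam.christoffel_eq [FiniteDimensional ℝ V] (h : IsLocalParam M U ψ)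
    (hB : ∀ v w, B v w = B w v) (hu : u ∈ U) (m i j : Fin k) :
    christoffel B ψ m i j u = ∑ l, (inducedMetric B ψ u)⁻¹ m l *
      B (fderiv ℝ (fderiv ℝ ψ) u (Pi.single i 1) (Pi.single j 1)) (coordField ψ l u) := by
  have hs : ∀ a b : Fin k → ℝ, fderiv ℝ (fderiv ℝ ψ) u a b = fderiv ℝ (fderiv ℝ ψ) u b a := by
    intro a b
    exact ((h.contDiffAt hu).isSymmSndFDerivAt
      (by rw [minSmoothness_of_isRCLikeNormedField]; norm_cast)).eq a b
  rw [christoffel, Finset.mul_sum]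
  refine Finset.sum_congr rfl fun l _ => ?_
  rw [h.metricPartial_eq hu, h.metricPartial_eq hu, h.metricPartial_eq hu,
    hs (Pi.single l 1) (Pi.single i 1), hs (Pi.single l 1) (Pi.single j 1),
    hs (Pi.single j 1) (Pi.single i 1), hB (coordField ψ j u), hB (coordField ψ i u)]
  ring

/-- A tangent field along a curve whose derivative is orthogonal to the tangent space of `M` is
parallel: the components of its covariant derivative are those of the tangential part of its
derivative in the ambient space. -/
theorem IsLocalParam.covDeriv_eq_zero [FiniteDimensional ℝ V] (h : IsLocalParam M U ψ)
    (hB : ∀ v w, B v w = B w v)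
    {x v : ℝ → Fin k → ℝ} {W : ℝ → V} {s : ℝ} (hx : DifferentiableAt ℝ x s)
    (hv : DifferentiableAt ℝ v s) (hxs : x s ∈ U)
    (hdet : IsUnit (inducedMetric B ψ (x s)).det)
    (hW : ∀ᶠ r in 𝓝 s, W r = fderiv ℝ ψ (x r) (v r))
    (hperp : ∀ l, B (deriv W s) (coordField ψ l (x s)) = 0) (m : Fin k) :
    deriv v s m + ∑ i, ∑ j, christoffel B ψ m i j (x s) * deriv x s i * v s j = 0 := by
  set A₂ := fderiv ℝ (fderiv ℝ ψ) (x s) with hA₂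
  set G := inducedMetric B ψ (x s) with hG
  have hdW : deriv W s = fderiv ℝ ψ (x s) (deriv v s) + A₂ (deriv x s) (v s) := by
    have h1 : HasDerivAt (fun r => fderiv ℝ ψ (x r)) (A₂ (deriv x s)) s :=
      (h.differentiableAt_fderiv hxs).hasFDerivAt.comp_hasDerivAt s hx.hasDerivAt
    have h2 := h1.clm_apply hv.hasDerivAt
    rw [Filter.EventuallyEq.deriv_eq hW, h2.deriv, add_comm]
  have hsum : A₂ (deriv x s) (v s) =
      ∑ i, ∑ j, (deriv x s i * v s j) • A₂ (Pi.single i 1) (Pi.single j 1) := by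
    conv_lhs => rw [pi_eq_sum_univ' (deriv x s), pi_eq_sum_univ' (v s)]
    simp only [map_sum, map_smul, sum_apply, smul_apply, Finset.smul_sum, smul_smul]
    rw [Finset.sum_comm]
    simp only [mul_comm]
  set c : Fin k → ℝ := fun l => B (A₂ (deriv x s) (v s)) (coordField ψ l (x s)) with hc
  have hΓ : ∑ i, ∑ j, christoffel B ψ m i j (x s) * deriv x s i * v s j =
      (G⁻¹.mulVec c) m := by
    simp_rw [h.christoffel_eq hB hxs, Matrix.mulVec, dotProduct, hc, hsum, map_sum,
      LinearMap.sum_apply, map_smul, LinearMap.smul_apply, smul_eq_mul, Finset.sum_mul,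
      Finset.mul_sum]
    rw [Finset.sum_comm_cycle]
    refine Finset.sum_congr rfl fun l _ => ?_
    refine Finset.sum_congr rfl fun i _ => Finset.sum_congr rfl fun j _ => ?_
    ring
  -- Pairing the derivative of `W` with the coordinate fields.
  have hGv : G.mulVec (deriv v s) + c = 0 := by
    funext l
    have := hperp l
    rw [hdW, fderiv_apply_eq_sum_coordField, map_add, LinearMap.add_apply, map_sum,
      LinearMap.sum_apply] at this
    rw [Pi.add_apply, Matrix.mulVec, dotProduct, Pi.zero_apply, ← this]
    congr 1
    refine Finset.sum_congr rfl fun i _ => ?_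
    simp [hG, inducedMetric, hB (coordField ψ l (x s)), mul_comm]
  have hv' : deriv v s = -G⁻¹.mulVec c := by
    have h3 := congrArg G⁻¹.mulVec hGv
    rw [Matrix.mulVec_add, Matrix.mulVec_mulVec, Matrix.nonsing_inv_mul _ hdet, Matrix.one_mulVec,
      Matrix.mulVec_zero] at h3
    exact eq_neg_of_add_eq_zero_left h3
  rw [hΓ, hv']
  simp

/-- The extrinsic criterion for parallel fields: `T p` is the tangent space of `M` at `p`. -/
theorem hasCovDerivAlong_zero [FiniteDimensional ℝ V] {T : V → Submodule ℝ V}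
    (hB : ∀ v w, B v w = B w v)
    (hM : IsPseudoRiemannianSubmanifold B k M)
    (hT : ∀ (U : Set (Fin k → ℝ)) (ψ : (Fin k → ℝ) → V), IsLocalParam M U ψ →
      ∀ u ∈ U, (fderiv ℝ ψ u).range = T (ψ u))
    {γ W : ℝ → V} {s : ℝ} (hγ : IsCurveIn M γ s) (hW : DifferentiableAt ℝ W s)
    (hWT : ∀ᶠ r in 𝓝 s, W r ∈ T (γ r)) (hperp : ∀ w ∈ T (γ s), B (deriv W s) w = 0) :
    HasCovDerivAlong B k M γ W s 0 := by
  intro U ψ h hs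
  obtain ⟨x, hx, hxU⟩ := h.exists_coordinates_of_curve hγ hs
  obtain ⟨hxs, hψs⟩ := hxU.self_of_nhds
  have hrange : ∀ᶠ r in 𝓝 s, W r ∈ Set.range (fderiv ℝ ψ (x r)) := by
    filter_upwards [hxU, hWT] with r hr hr'
    rw [hr.2, ← hT U ψ h _ hr.1] at hr'
    exact hr'
  obtain ⟨v, hv, hWv⟩ := h.exists_components_of_field hx hxs hW hrange
  refine ⟨x, v, hx, hv, ?_, ?_⟩
  · filter_upwards [hxU, hWv] with r hr hr'
    exact ⟨hr.1, hr.2, by rw [hr', fderiv_apply_eq_sum_coordField]⟩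
  · symm
    refine Finset.sum_eq_zero fun m _ => ?_
    rw [h.covDeriv_eq_zero hB hx hv hxs (hM.2 U ψ h _ hxs) hWv, zero_smul]
    intro l
    refine hperp _ ?_
    rw [hψs, ← hT U ψ h _ hxs]
    exact ⟨_, rfl⟩

theorem IsLocalParam.isUnit_det_inducedMetric {T : Submodule ℝ V} (h : IsLocalParam M U ψ)
    (hu : u ∈ U) (hT : (fderiv ℝ ψ u).range = T)
    (hnd : ∀ v ∈ T, (∀ w ∈ T, B w v = 0) → v = 0) :
    IsUnit (inducedMetric B ψ u).det := by
  rw [isUnit_iff_ne_zero]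
  intro h0
  obtain ⟨x, hx, hx0⟩ := Matrix.exists_mulVec_eq_zero_iff.mpr h0
  refine hx (h.immersion u hu ?_)
  rw [map_zero]
  refine hnd _ (hT ▸ ⟨x, rfl⟩) ?_
  rw [← hT]
  rintro _ ⟨w, rfl⟩
  have h1 : ∀ l, B (coordField ψ l u) (fderiv ℝ ψ u x) = 0 := by
    intro l
    rw [fderiv_apply_eq_sum_coordField, map_sum]
    have := congrFun hx0 l
    simpa [Matrix.mulVec, dotProduct, inducedMetric, mul_comm] using this
  simp only [ContinuousLinearMap.coe_coe]
  rw [fderiv_apply_eq_sum_coordField ψ u w, map_sum, LinearMap.sum_apply]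
  exact Finset.sum_eq_zero fun l _ => by simp [h1]

end Christoffel

/-- The image of a local parametrization under a linear automorphism. -/
theorem IsLocalParam.map_equiv {k : ℕ} {M : Set V} {U : Set (Fin k → ℝ)} {ψ : (Fin k → ℝ) → V}
    (h : IsLocalParam M U ψ) (A : V ≃L[ℝ] V) :
    IsLocalParam (A '' M) U (A ∘ ψ) where
  isOpen := h.isOpen
  smooth := A.contDiff.comp_contDiffOn h.smooth
  immersion u hu := by
    rw [A.comp_fderiv]
    exact A.injective.comp (h.immersion u hu)
  embedding := A.toHomeomorph.isEmbedding.comp h.embedding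
  image := by
    obtain ⟨O, hO, hOim⟩ := h.image
    refine ⟨A '' O, A.toHomeomorph.isOpenMap O hO, ?_⟩
    rw [Set.image_comp, hOim, Set.image_inter A.injective]

/-- A set is a submanifold if linear automorphisms that preserve it move each of its points to the
image of one local parametrization. -/
theorem IsSubmanifold.of_homogeneous {k : ℕ} {M : Set V} {U : Set (Fin k → ℝ)}
    {ψ : (Fin k → ℝ) → V} (h : IsLocalParam M U ψ) {p₀ : V} (hp₀ : p₀ ∈ ψ '' U)
    (hA : ∀ p ∈ M, ∃ A : V ≃L[ℝ] V, (∀ q, A q ∈ M ↔ q ∈ M) ∧ A p₀ = p) : IsSubmanifold k M := by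
  intro p hp
  obtain ⟨A, hA', rfl⟩ := hA p hp
  have hAM : A '' M = M := by
    have : A ⁻¹' M = M := Set.ext hA'
    conv_lhs => rw [← this, Set.image_preimage_eq M A.surjective]
  refine ⟨U, A ∘ ψ, ?_, ?_⟩
  · have := h.map_equiv A
    rwa [hAM] at this
  · rw [Set.image_comp]
    exact Set.mem_image_of_mem A hp₀

/-- A smooth map with a linear left inverse `π`, such as a graph, is a local parametrization. -/
theorem IsLocalParam.of_leftInverse {k : ℕ} {M O : Set V} {U : Set (Fin k → ℝ)}
    {ψ : (Fin k → ℝ) → V} (π : V →L[ℝ] (Fin k → ℝ)) (hU : IsOpen U) (hψ : ContDiffOn ℝ ∞ ψ U)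
    (hπ : ∀ u, π (ψ u) = u) (hO : IsOpen O) (hmaps : ∀ u ∈ U, ψ u ∈ M ∩ O)
    (hsurj : ∀ p ∈ M ∩ O, π p ∈ U ∧ ψ (π p) = p) :
    IsLocalParam M U ψ ∧ ψ '' U = M ∩ O := by
  have himage : ψ '' U = M ∩ O := by
    refine Set.Subset.antisymm ?_ fun p hp => ⟨π p, (hsurj p hp).1, (hsurj p hp).2⟩
    rintro _ ⟨u, hu, rfl⟩
    exact hmaps u hu
  refine ⟨⟨hU, hψ, fun u hu => ?_, ?_, O, hO, himage⟩, himage⟩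
  · have h1 : HasFDerivAt (fun u => π (ψ u)) (π.comp (fderiv ℝ ψ u)) u :=
      π.hasFDerivAt.comp u
        ((hψ.contDiffAt (hU.mem_nhds hu)).differentiableAt (by simp)).hasFDerivAt
    have h2 : π.comp (fderiv ℝ ψ u) = ContinuousLinearMap.id ℝ _ := by
      refine h1.unique ?_
      simp_rw [hπ]
      exact hasFDerivAt_id u
    refine Function.LeftInverse.injective (g := π) fun w => ?_
    exact DFunLike.congr_fun h2 w
  · have hc : Continuous (U.domRestrict ψ) :=
      continuousOn_iff_continuous_domRestrict.mp hψ.continuousOn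
    refine Topology.IsEmbedding.of_comp (g := π) hc π.continuous ?_
    have : (⇑π ∘ U.domRestrict ψ) = Subtype.val := funext fun u => hπ u
    rw [this]
    exact Topology.IsEmbedding.subtypeVal

end Geometry

/-! ### Bivectors as vectors of `ℂ³` -/

theorem update_pair_zero (x y z : E41) : Function.update ![x, y] 0 z = ![z, y] := by
  ext i j
  fin_cases i <;> rfl

theorem wedge_add_left (x x' y : E41) : wedge (x + x') y = wedge x y + wedge x' y := by
  have := (exteriorPower.ιMulti ℝ 2 (M := E41)).map_update_add ![x, y] 0 x x'
  rwa [update_pair_zero, update_pair_zero, update_pair_zero] at this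

theorem wedge_smul_left (c : ℝ) (x y : E41) : wedge (c • x) y = c • wedge x y := by
  have := (exteriorPower.ιMulti ℝ 2 (M := E41)).map_update_smul ![x, y] 0 c x
  rwa [update_pair_zero, update_pair_zero] at this

theorem wedge_swap (x y : E41) : wedge y x = -wedge x y := by
  have := (exteriorPower.ιMulti ℝ 2 (M := E41)).map_swap ![x, y] (i := 0) (j := 1) (by decide)
  rw [wedge, wedge, ← this]
  congr 1
  ext i j
  fin_cases i <;> rfl

theorem wedge_self (x : E41) : wedge x x = 0 :=
  (exteriorPower.ιMulti ℝ 2 (M := E41)).map_eq_zero_of_eq ![x, x] (i := 0) (j := 1) rfl (by decide)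

theorem wedge_add_right (x y y' : E41) : wedge x (y + y') = wedge x y + wedge x y' := by
  rw [wedge_swap, wedge_add_left, wedge_swap x, wedge_swap x]
  abel

theorem wedge_smul_right (c : ℝ) (x y : E41) : wedge x (c • y) = c • wedge x y := by
  rw [wedge_swap, wedge_smul_left, wedge_swap x]
  simp

theorem bivector_hom_ext {N : Type*} [AddCommGroup N] [Module ℝ N] {f g : Bivector →ₗ[ℝ] N}
    (h : ∀ x y, f (wedge x y) = g (wedge x y)) : f = g := by
  refine exteriorPower.linearMap_ext ?_
  ext v
  have hv : v = ![v 0, v 1] := by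
    ext i
    fin_cases i <;> rfl
  rw [hv]
  exact h (v 0) (v 1)

/-- The Plücker coordinate `p_{ij}` of a bivector with respect to a basis. -/
noncomputable def pluecker (e : Module.Basis (Fin 4) ℝ E41) (i j : Fin 4) : Bivector →ₗ[ℝ] ℝ :=
  exteriorPower.pairingDual ℝ E41 2 (exteriorPower.ιMulti ℝ 2 ![e.coord i, e.coord j])

theorem pluecker_wedge (e : Module.Basis (Fin 4) ℝ E41) (i j : Fin 4) (x y : E41) :
    pluecker e i j (wedge x y) = e.repr x i * e.repr y j - e.repr x j * e.repr y i := by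
  simp only [pluecker, wedge, exteriorPower.pairingDual_ιMulti_ιMulti, Matrix.det_fin_two]
  simp

theorem sum_pluecker_smul_wedge (e : Module.Basis (Fin 4) ℝ E41) (p : Bivector) :
    pluecker e 0 1 p • wedge (e 0) (e 1) + pluecker e 2 3 p • wedge (e 2) (e 3) +
      pluecker e 0 2 p • wedge (e 0) (e 2) + pluecker e 3 1 p • wedge (e 3) (e 1) +
      pluecker e 1 2 p • wedge (e 1) (e 2) + pluecker e 0 3 p • wedge (e 0) (e 3) = p := by
  have h : (pluecker e 0 1).smulRight (wedge (e 0) (e 1)) +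
      (pluecker e 2 3).smulRight (wedge (e 2) (e 3)) +
      (pluecker e 0 2).smulRight (wedge (e 0) (e 2)) +
      (pluecker e 3 1).smulRight (wedge (e 3) (e 1)) +
      (pluecker e 1 2).smulRight (wedge (e 1) (e 2)) +
      (pluecker e 0 3).smulRight (wedge (e 0) (e 3)) = LinearMap.id := by
    refine bivector_hom_ext fun x y => ?_
    simp only [LinearMap.add_apply, LinearMap.smulRight_apply, pluecker_wedge, LinearMap.id_apply]
    conv_rhs => rw [← e.sum_repr x, ← e.sum_repr y]
    simp only [Fin.sum_univ_four, wedge_add_left, wedge_add_right, wedge_smul_left,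
      wedge_smul_right, wedge_self, wedge_swap (e 0), wedge_swap (e 1) (e 2),
      wedge_swap (e 2) (e 3), wedge_swap (e 3) (e 1)]
    module
  exact LinearMap.congr_fun h p

/-- The identification of bivectors with `ℂ³`, where a bivector with Plücker coordinates `p_{ij}`
(numbered from `0`) has the components `p₀₁ + i p₂₃`, `p₀₂ + i p₃₁` and `p₁₂ + i p₀₃`. -/
noncomputable def complexCoord (e : Module.Basis (Fin 4) ℝ E41) :
    Bivector ≃ₗ[ℝ] (Fin 3 → ℂ) where
  toFun p := ![⟨pluecker e 0 1 p, pluecker e 2 3 p⟩, ⟨pluecker e 0 2 p, pluecker e 3 1 p⟩,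
    ⟨pluecker e 1 2 p, pluecker e 0 3 p⟩]
  map_add' p p' := by
    ext i
    fin_cases i <;> apply Complex.ext <;> simp
  map_smul' c p := by
    ext i
    fin_cases i <;> apply Complex.ext <;> simp
  invFun z := (z 0).re • wedge (e 0) (e 1) + (z 0).im • wedge (e 2) (e 3) +
    (z 1).re • wedge (e 0) (e 2) + (z 1).im • wedge (e 3) (e 1) +
    (z 2).re • wedge (e 1) (e 2) + (z 2).im • wedge (e 0) (e 3)
  left_inv p := sum_pluecker_smul_wedge e p
  right_inv z := by
    ext i
    fin_cases i <;> apply Complex.ext <;> simp [pluecker_wedge]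

section Coordinates

variable (e : Module.Basis (Fin 4) ℝ E41)

theorem complexCoord_zero (p : Bivector) :
    complexCoord e p 0 = ⟨pluecker e 0 1 p, pluecker e 2 3 p⟩ := rfl

theorem complexCoord_one (p : Bivector) :
    complexCoord e p 1 = ⟨pluecker e 0 2 p, pluecker e 3 1 p⟩ := rfl

theorem complexCoord_two (p : Bivector) :
    complexCoord e p 2 = ⟨pluecker e 1 2 p, pluecker e 0 3 p⟩ := rfl

theorem pluecker_bivectorMap (A : Matrix (Fin 4) (Fin 4) ℝ) (k l : Fin 4) (p : Bivector) :
    pluecker e k l (bivectorMap (Matrix.toLin e e A) p) =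
      (A k 0 * A l 1 - A l 0 * A k 1) * pluecker e 0 1 p +
      (A k 2 * A l 3 - A l 2 * A k 3) * pluecker e 2 3 p +
      (A k 0 * A l 2 - A l 0 * A k 2) * pluecker e 0 2 p +
      (A k 3 * A l 1 - A l 3 * A k 1) * pluecker e 3 1 p +
      (A k 1 * A l 2 - A l 1 * A k 2) * pluecker e 1 2 p +
      (A k 0 * A l 3 - A l 0 * A k 3) * pluecker e 0 3 p := by
  have hr : ∀ i j, e.repr (Matrix.toLin e e A (e j)) i = A i j := by
    intro i j
    rw [Matrix.toLin_self, Module.Basis.repr_sum_self]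
  conv_lhs => rw [← sum_pluecker_smul_wedge e p]
  simp only [map_add, map_smul, bivectorMap_wedge, pluecker_wedge, hr, smul_eq_mul]
  ring

/-- The symmetric form `(p, p') ↦ ∑ zᵢ(p) zᵢ(p')` with values in `ℂ`, for the complex coordinates
`zᵢ`. Its real part is the metric on bivectors, its imaginary part the pairing `⋀² × ⋀² → ⋀⁴`. -/
noncomputable def complexForm : Bivector →ₗ[ℝ] Bivector →ₗ[ℝ] ℂ :=
  LinearMap.mk₂ ℝ (fun p p' => complexCoord e p ⬝ᵥ complexCoord e p')
    (by intros; simp [add_dotProduct]) (by intros; simp [smul_dotProduct])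
    (by intros; simp [dotProduct_add]) (by intros; simp [dotProduct_smul])

theorem complexForm_apply (p p' : Bivector) :
    complexForm e p p' = complexCoord e p 0 * complexCoord e p' 0 +
      complexCoord e p 1 * complexCoord e p' 1 + complexCoord e p 2 * complexCoord e p' 2 :=
  Matrix.vec3_dotProduct _ _

theorem complexForm_comm (p p' : Bivector) : complexForm e p p' = complexForm e p' p := by
  simp only [complexForm_apply]
  ring

theorem im_complexForm_wedge (x y u v : E41) :
    (complexForm e (wedge x y) (wedge u v)).im = e.det ![x, y, u, v] := by
  simp only [complexForm_apply, complexCoord_zero, complexCoord_one, complexCoord_two,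
    pluecker_wedge, Complex.add_im, Complex.mul_im, Module.Basis.det_apply]
  simp [Matrix.det_succ_row_zero, Fin.sum_univ_succ, Module.Basis.toMatrix_apply, Fin.succAbove]
  ring

theorem bilinear_hom_ext {f g : Bivector →ₗ[ℝ] Bivector →ₗ[ℝ] ℝ}
    (h : ∀ x y u v, f (wedge x y) (wedge u v) = g (wedge x y) (wedge u v)) : f = g :=
  bivector_hom_ext fun x y => bivector_hom_ext fun u v => h x y u v

theorem im_complexForm_bivectorMap (P : E41 →ₗ[ℝ] E41) (p p' : Bivector) :
    (complexForm e (bivectorMap P p) (bivectorMap P p')).im =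
      LinearMap.det P * (complexForm e p p').im := by
  have h : ((complexForm e).compr₂ Complex.imLm).compl₁₂ (bivectorMap P) (bivectorMap P) =
      LinearMap.det P • (complexForm e).compr₂ Complex.imLm := by
    refine bilinear_hom_ext fun x y u v => ?_
    have := e.det_comp P ![x, y, u, v]
    simp only [LinearMap.compl₁₂_apply, LinearMap.compr₂_apply, bivectorMap_wedge,
      LinearMap.smul_apply, Complex.imLm_coe, im_complexForm_wedge, smul_eq_mul]
    rw [← this]
    congr 1
    ext i j
    fin_cases i <;> rfl
  exact LinearMap.congr_fun₂ h p p'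

variable {e}

theorem minkowski_eq_repr (he : IsOrientedPseudoOrthonormal e) (x y : E41) :
    minkowski x y = ⇑(e.repr x) ⬝ᵥ minkowskiMatrix.mulVec (e.repr y) := by
  conv_lhs => rw [← e.sum_repr x, ← e.sum_repr y]
  simp only [Fin.sum_univ_four, map_add, map_smul, LinearMap.add_apply, LinearMap.smul_apply,
    he.1]
  simp [dotProduct, Fin.sum_univ_four, minkowskiMatrix, Matrix.mulVec_diagonal]
  ring

theorem minkowski_toLin (he : IsOrientedPseudoOrthonormal e) {A : Matrix (Fin 4) (Fin 4) ℝ}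
    {c : ℝ} (hA : A.transpose * minkowskiMatrix * A = c • minkowskiMatrix) (x y : E41) :
    minkowski (Matrix.toLin e e A x) (Matrix.toLin e e A y) = c * minkowski x y := by
  have hr : ∀ z, ⇑(e.repr (Matrix.toLin e e A z)) = A.mulVec (e.repr z) :=
    fun z => Matrix.repr_toLin e e A z
  rw [minkowski_eq_repr he, minkowski_eq_repr he, hr, hr, Matrix.dotProduct_mulVec,
    ← Matrix.vecMul_transpose, Matrix.vecMul_vecMul, Matrix.dotProduct_mulVec,
    Matrix.vecMul_vecMul, hA, ← Matrix.dotProduct_mulVec, Matrix.smul_mulVec, dotProduct_smul,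
    smul_eq_mul]

theorem toLin_mem_SO31 (he : IsOrientedPseudoOrthonormal e) {A : Matrix (Fin 4) (Fin 4) ℝ}
    (hA : A.transpose * minkowskiMatrix * A = minkowskiMatrix) (hdet : A.det = 1) :
    Matrix.toLin e e A ∈ SO31 := by
  refine ⟨fun x y => ?_, by rw [LinearMap.det_toLin, hdet]⟩
  rw [minkowski_toLin he (c := 1) (by rw [hA, one_smul]), one_mul]

theorem bivectorMetric_eq_re (he : IsOrientedPseudoOrthonormal e) (p p' : Bivector) :
    bivectorMetric p p' = (complexForm e p p').re := by
  have h : bivectorMetric = (complexForm e).compr₂ Complex.reLm := by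
    refine bilinear_hom_ext fun x y u v => ?_
    simp only [LinearMap.compr₂_apply, Complex.reLm_coe, bivectorMetric_wedge,
      complexForm_apply, complexCoord_zero, complexCoord_one, complexCoord_two,
      pluecker_wedge, Complex.add_re, Complex.mul_re, minkowski_eq_repr he]
    simp [dotProduct, Fin.sum_univ_four, minkowskiMatrix, Matrix.mulVec_diagonal]
    ring
  exact LinearMap.congr_fun₂ h p p'

theorem bivectorMetric_bivectorMap {P : E41 →ₗ[ℝ] E41}
    (hP : ∀ x y, minkowski (P x) (P y) = minkowski x y) (p p' : Bivector) :
    bivectorMetric (bivectorMap P p) (bivectorMap P p') = bivectorMetric p p' := by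
  have h : bivectorMetric.compl₁₂ (bivectorMap P) (bivectorMap P) = bivectorMetric :=
    bilinear_hom_ext fun x y u v => by
      simp only [LinearMap.compl₁₂_apply, bivectorMap_wedge, bivectorMetric_wedge, hP]
  exact LinearMap.congr_fun₂ h p p'

theorem complexForm_bivectorMap (he : IsOrientedPseudoOrthonormal e) {P : E41 →ₗ[ℝ] E41}
    (hP : P ∈ SO31) (p p' : Bivector) :
    complexForm e (bivectorMap P p) (bivectorMap P p') = complexForm e p p' := by
  apply Complex.ext
  · rw [← bivectorMetric_eq_re he, ← bivectorMetric_eq_re he, bivectorMetric_bivectorMap hP.1]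
  · rw [im_complexForm_bivectorMap, hP.2, one_mul]

/-! ### The energy-momentum tensor -/

/-- The energy-momentum tensor of the bivector with complex coordinates `f`, regarded as an
electromagnetic field. With `F` the skew endomorphism given by the bivector, it is the trace-free
part of `F²`. -/
noncomputable def energyMomentum (f : Fin 3 → ℂ) : Matrix (Fin 4) (Fin 4) ℝ :=
  let a := (f 0).re
  let b := (f 0).im
  let c := (f 1).re
  let d := (f 1).im
  let g := (f 2).re
  let h := (f 2).im
  !![(-a ^ 2 - c ^ 2 + g ^ 2 - b ^ 2 - d ^ 2 + h ^ 2) / 2, -c * g - h * d, a * g + h * b,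
      a * d - c * b;
    -g * c - d * h, (-a ^ 2 + c ^ 2 - g ^ 2 - b ^ 2 + d ^ 2 - h ^ 2) / 2, -a * c - d * b,
      a * h - g * b;
    g * a + b * h, -c * a - b * d, (a ^ 2 - c ^ 2 - g ^ 2 + b ^ 2 - d ^ 2 - h ^ 2) / 2,
      c * h - g * d;
    -d * a + b * c, -h * a + b * g, -h * c + d * g,
      (a ^ 2 + b ^ 2 + c ^ 2 + d ^ 2 + g ^ 2 + h ^ 2) / 2]

/-- The Rainich identity: the square of the energy-momentum tensor is scalar. -/
theorem transpose_energyMomentum_mul (f : Fin 3 → ℂ) :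
    (energyMomentum f).transpose * minkowskiMatrix * energyMomentum f =
      (Complex.normSq (f 0 * f 0 + f 1 * f 1 + f 2 * f 2) / 4) • minkowskiMatrix := by
  ext i j
  fin_cases i <;> fin_cases j <;>
    simp [energyMomentum, minkowskiMatrix, Matrix.mul_apply, Fin.sum_univ_four,
      Complex.normSq_apply, Matrix.diagonal] <;> ring

/-- If `f` is not isotropic, its energy-momentum tensor acts on bivectors, up to a factor, as the
half-turn of `ℂ³` about the axis `f`. -/
theorem complexCoord_bivectorMap_energyMomentum (f p : Bivector) (i : Fin 3) :
    complexCoord e (bivectorMap (Matrix.toLin e e (energyMomentum (complexCoord e f))) p) i =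
      (-Complex.normSq (complexForm e f f) * complexCoord e p i +
        2 * (starRingEnd ℂ) (complexForm e f f) * complexForm e p f * complexCoord e f i) / 4 := by
  have h4 : (4 : ℂ) ≠ 0 := by norm_num
  rw [eq_div_iff h4]
  fin_cases i <;> apply Complex.ext <;>
    simp [complexCoord_zero, complexCoord_one, complexCoord_two, pluecker_bivectorMap,
      complexForm_apply, energyMomentum, Complex.normSq_apply] <;> ring

end Coordinates

/-! ### The orbit and the quadric -/

section Orbit

variable {e : Module.Basis (Fin 4) ℝ E41}

theorem bivectorMap_comp (P Q : E41 →ₗ[ℝ] E41) (p : Bivector) :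
    bivectorMap (P ∘ₗ Q) p = bivectorMap P (bivectorMap Q p) := by
  simp [bivectorMap, exteriorPower.map_comp]

theorem bivectorMap_smul (c : ℝ) (P : E41 →ₗ[ℝ] E41) :
    bivectorMap (c • P) = c ^ 2 • bivectorMap P :=
  bivector_hom_ext fun x y => by
    simp only [bivectorMap_wedge, LinearMap.smul_apply, wedge_smul_left, wedge_smul_right,
      smul_smul, sq]

theorem comp_mem_SO31 {P Q : E41 →ₗ[ℝ] E41} (hP : P ∈ SO31) (hQ : Q ∈ SO31) : P ∘ₗ Q ∈ SO31 :=
  ⟨fun x y => by simp [hP.1, hQ.1], by rw [LinearMap.det_comp, hP.2, hQ.2, one_mul]⟩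

theorem exists_inverse_mem_SO31 {P : E41 →ₗ[ℝ] E41} (hP : P ∈ SO31) :
    ∃ Q ∈ SO31, P ∘ₗ Q = LinearMap.id ∧ Q ∘ₗ P = LinearMap.id := by
  have hu : IsUnit (LinearMap.det P) := by rw [hP.2]; exact isUnit_one
  obtain ⟨Q, hQ⟩ := ((LinearMap.isUnit_iff_isUnit_det P).mpr hu).exists_right_inv
  have hQ' : Q * P = 1 := mul_eq_one_comm.mp hQ
  have hPQ : ∀ x, P (Q x) = x := fun x => LinearMap.congr_fun hQ x
  refine ⟨Q, ⟨fun x y => ?_, ?_⟩, hQ, hQ'⟩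
  · rw [← hP.1, hPQ, hPQ]
  · have := congrArg LinearMap.det hQ
    rwa [map_mul, hP.2, one_mul, map_one] at this

theorem exists_equiv_eq_bivectorMap {P : E41 →ₗ[ℝ] E41} (hP : P ∈ SO31) :
    ∃ A : Bivector ≃L[ℝ] Bivector, ∀ p, A p = bivectorMap P p := by
  obtain ⟨Q, -, hPQ, hQP⟩ := exists_inverse_mem_SO31 hP
  have hid : bivectorMap LinearMap.id = LinearMap.id := exteriorPower.map_id
  refine ⟨(LinearEquiv.ofLinearMap (bivectorMap P) (bivectorMap Q) ?_ ?_).toContinuousLinearEquiv,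
    fun p => rfl⟩
  · refine LinearMap.ext fun p => ?_
    rw [LinearMap.comp_apply, ← bivectorMap_comp, hPQ, hid]
  · refine LinearMap.ext fun p => ?_
    rw [LinearMap.comp_apply, ← bivectorMap_comp, hQP, hid]

theorem bivectorMap_mem_so31Orbit_iff {P : E41 →ₗ[ℝ] E41} (hP : P ∈ SO31) {Ω p : Bivector} :
    bivectorMap P p ∈ so31Orbit Ω ↔ p ∈ so31Orbit Ω := by
  constructor
  · rintro ⟨R, hR, h⟩
    obtain ⟨Q, hQ, -, hQP⟩ := exists_inverse_mem_SO31 hP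
    refine ⟨Q ∘ₗ R, comp_mem_SO31 hQ hR, ?_⟩
    rw [bivectorMap_comp, ← h, ← bivectorMap_comp, hQP]
    exact (LinearMap.congr_fun exteriorPower.map_id p).symm
  · rintro ⟨R, hR, rfl⟩
    exact ⟨P ∘ₗ R, comp_mem_SO31 hP hR, (bivectorMap_comp P R Ω).symm⟩

/-- Two bivectors with the same value of the complex form are exchanged by the half-turn about
their sum, provided that it is not isotropic. The half-turn comes from a Lorentz transformation,
the normalized energy-momentum tensor of the sum. -/
theorem mem_so31Orbit_of_complexForm_eq (he : IsOrientedPseudoOrthonormal e) {Ω p : Bivector}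
    (hp : complexForm e p p = complexForm e Ω Ω) (him : (complexForm e Ω Ω).im ≠ 0)
    (hne : complexForm e (p + Ω) (p + Ω) ≠ 0) : p ∈ so31Orbit Ω := by
  set f := p + Ω with hf
  set μ := complexForm e f f with hμ
  have hμ2 : μ = 2 * complexForm e Ω f := by
    simp only [hμ, hf, map_add, LinearMap.add_apply, hp, complexForm_comm e p Ω]
    ring
  have hn : ‖μ‖ ≠ 0 := norm_ne_zero_iff.mpr hne
  set P := (2 / ‖μ‖) • Matrix.toLin e e (energyMomentum (complexCoord e f)) with hP
  have hiso : ∀ x y, minkowski (P x) (P y) = minkowski x y := by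
    intro x y
    simp only [hP, LinearMap.smul_apply, map_smul, smul_eq_mul]
    rw [minkowski_toLin he (transpose_energyMomentum_mul _), ← complexForm_apply, ← hμ,
      Complex.normSq_eq_norm_sq]
    field_simp
    ring
  have hmap : bivectorMap P Ω = p := by
    apply (complexCoord e).injective
    ext1 i
    have hc : (starRingEnd ℂ) μ * μ = (‖μ‖ : ℂ) ^ 2 := Complex.conj_mul' μ
    have hn' : (‖μ‖ : ℂ) ≠ 0 := by exact_mod_cast hn
    rw [hP, bivectorMap_smul, LinearMap.smul_apply, map_smul, Pi.smul_apply,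
      complexCoord_bivectorMap_energyMomentum, ← hμ, Complex.real_smul]
    have h2 : 2 * (starRingEnd ℂ) μ * complexForm e Ω f = (‖μ‖ : ℂ) ^ 2 := by
      rw [← hc, hμ2]
      ring
    rw [h2, Complex.normSq_eq_norm_sq, hf, map_add, Pi.add_apply]
    push_cast
    field_simp
    ring
  refine ⟨P, ⟨hiso, ?_⟩, hmap.symm⟩
  -- The imaginary part of the complex form is multiplied by `det P`, and has the same nonzero value
  -- at `Ω` and at its image `p`.
  have hdet := im_complexForm_bivectorMap e P Ω Ω
  rw [hmap, hp] at hdet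
  exact (mul_right_cancel₀ him (by rw [one_mul]; exact hdet)).symm

theorem complexForm_of_mem_so31Orbit (he : IsOrientedPseudoOrthonormal e) {Ω p : Bivector}
    (hp : p ∈ so31Orbit Ω) : complexForm e p p = complexForm e Ω Ω := by
  obtain ⟨P, hP, rfl⟩ := hp
  exact complexForm_bivectorMap he hP Ω Ω

end Orbit

/-! ### Parametrization and tangent spaces of the quadric -/

section Quadric

variable (e : Module.Basis (Fin 4) ℝ E41)

/-- The graph `z₀ = σ √(μ - z₁² - z₂²)` over the subspace parametrized by `ι` of the plane with
coordinates `(z₁, z₂)`, where `√` is the principal branch. -/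
noncomputable def quadricGraph {k : ℕ} (σ : ℝ) (μ : ℂ) (ι : (Fin k → ℝ) →ₗ[ℝ] ℂ × ℂ)
    (u : Fin k → ℝ) : Bivector :=
  (complexCoord e).symm
    ![σ * (μ - (ι u).1 ^ 2 - (ι u).2 ^ 2) ^ (2⁻¹ : ℂ), (ι u).1, (ι u).2]

theorem continuous_complexCoord (i : Fin 3) : Continuous fun p => complexCoord e p i :=
  (continuous_apply i).comp (complexCoord e).toLinearMap.continuous_of_finiteDimensional

theorem contDiffOn_quadricGraph {k : ℕ} (σ : ℝ) (μ : ℂ) (ι : (Fin k → ℝ) →ₗ[ℝ] ℂ × ℂ) :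
    ContDiffOn ℝ ∞ (quadricGraph e σ μ ι)
      {u | μ - (ι u).1 ^ 2 - (ι u).2 ^ 2 ∈ Complex.slitPlane} := by
  have hι : ContDiff ℝ ∞ ι := (LinearMap.toContinuousLinearMap ι).contDiff
  have h1 : ContDiff ℝ ∞ fun u => (ι u).1 := contDiff_fst.comp hι
  have h2 : ContDiff ℝ ∞ fun u => (ι u).2 := contDiff_snd.comp hι
  refine (LinearMap.toContinuousLinearMap
    (complexCoord e).symm.toLinearMap).contDiff.comp_contDiffOn ?_
  rw [contDiffOn_pi]
  intro i
  fin_cases i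
  · intro u hu
    refine ContDiffAt.contDiffWithinAt ?_
    have h3 : ContDiffAt ℝ ∞ (fun z : ℂ => z ^ (2⁻¹ : ℂ)) (μ - (ι u).1 ^ 2 - (ι u).2 ^ 2) := by
      have h4 : ContDiffAt ℂ ∞ (fun z : ℂ => Complex.exp (Complex.log z * 2⁻¹))
          (μ - (ι u).1 ^ 2 - (ι u).2 ^ 2) :=
        ((Complex.contDiffAt_log hu).mul contDiffAt_const).cexp
      refine (h4.restrict_scalars ℝ).congr_of_eventuallyEq ?_
      filter_upwards [isOpen_ne.mem_nhds (Complex.slitPlane_ne_zero hu)] with z hz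
      exact Complex.cpow_def_of_ne_zero hz _
    have h5 : ContDiffAt ℝ ∞ (fun u => μ - (ι u).1 ^ 2 - (ι u).2 ^ 2) u :=
      ((contDiff_const.sub (h1.pow 2)).sub (h2.pow 2)).contDiffAt
    exact contDiffAt_const.mul (ContDiffAt.comp (g := fun z : ℂ => z ^ (2⁻¹ : ℂ)) u h3 h5)
  · exact h1.contDiffOn
  · exact h2.contDiffOn

/-- On the part `σ Re z₀ > 0` of the quadric `z₀² + z₁² + z₂² = μ`, or of its intersection with a
linear subspace in `(z₁, z₂)`, the graph is a local parametrization. -/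
theorem isLocalParam_quadricGraph {k : ℕ} {σ : ℝ} (hσ : σ * σ = 1) {μ : ℂ}
    {ι : (Fin k → ℝ) →ₗ[ℝ] ℂ × ℂ} {κ : ℂ × ℂ →ₗ[ℝ] (Fin k → ℝ)} (hκ : ∀ u, κ (ι u) = u)
    {M O : Set Bivector} (hO : IsOpen O) (hσO : ∀ p ∈ O, 0 < σ * (complexCoord e p 0).re)
    (hMO : ∀ p ∈ O, p ∈ M ↔ complexForm e p p = μ ∧
      ι (κ (complexCoord e p 1, complexCoord e p 2)) = (complexCoord e p 1, complexCoord e p 2)) :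
    IsLocalParam M ({u | μ - (ι u).1 ^ 2 - (ι u).2 ^ 2 ∈ Complex.slitPlane} ∩
      quadricGraph e σ μ ι ⁻¹' O) (quadricGraph e σ μ ι) ∧
    quadricGraph e σ μ ι '' ({u | μ - (ι u).1 ^ 2 - (ι u).2 ^ 2 ∈ Complex.slitPlane} ∩
      quadricGraph e σ μ ι ⁻¹' O) = M ∩ O := by
  have hσ' : (σ : ℂ) * σ = 1 := by exact_mod_cast hσ
  have hιc : Continuous ι := ι.continuous_of_finiteDimensional
  have hopen : IsOpen {u | μ - (ι u).1 ^ 2 - (ι u).2 ^ 2 ∈ Complex.slitPlane} :=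
    Complex.isOpen_slitPlane.preimage (by fun_prop)
  have hsmooth := contDiffOn_quadricGraph e σ μ ι
  refine IsLocalParam.of_leftInverse (O := O)
    (LinearMap.toContinuousLinearMap (κ ∘ₗ ((LinearMap.proj 1).prod (LinearMap.proj 2) :
      (Fin 3 → ℂ) →ₗ[ℝ] ℂ × ℂ) ∘ₗ (complexCoord e).toLinearMap))
    (hsmooth.continuousOn.isOpen_inter_preimage hopen hO)
    (hsmooth.mono Set.inter_subset_left) ?_ hO ?_ ?_
  · intro u
    simp [quadricGraph, hκ]
  · rintro u ⟨hu, huO⟩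
    refine ⟨(hMO _ huO).mpr ⟨?_, ?_⟩, huO⟩
    · have hsq := Complex.cpow_ofNat_inv_pow (μ - (ι u).1 ^ 2 - (ι u).2 ^ 2) 2
      rw [complexForm_apply]
      simp only [quadricGraph, LinearEquiv.apply_symm_apply, Matrix.cons_val_zero,
        Matrix.cons_val_one, Matrix.cons_val]
      linear_combination (((μ - (ι u).1 ^ 2 - (ι u).2 ^ 2) ^ (2⁻¹ : ℂ)) ^ 2) * hσ' + hsq
    · simp [quadricGraph, hκ]
  · rintro p ⟨hpM, hpO⟩
    obtain ⟨hq, hι⟩ := (hMO p hpO).mp hpM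
    have hre : 0 < ((σ : ℂ) * complexCoord e p 0).re := by
      simpa using hσO p hpO
    have hval : μ - complexCoord e p 1 ^ 2 - complexCoord e p 2 ^ 2 =
        ((σ : ℂ) * complexCoord e p 0) ^ 2 := by
      rw [complexForm_apply] at hq
      linear_combination -hq - (complexCoord e p 0) ^ 2 * hσ'
    have hψ : quadricGraph e σ μ ι (κ (complexCoord e p 1, complexCoord e p 2)) = p := by
      rw [quadricGraph, LinearEquiv.symm_apply_eq, hι]
      ext1 i
      fin_cases i
      · simp only [Fin.zero_eta, Matrix.cons_val_zero]
        rw [hval, Complex.sq_cpow_two_inv hre, ← mul_assoc, hσ', one_mul]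
      · rfl
      · rfl
    refine ⟨⟨?_, ?_⟩, hψ⟩
    · change μ - (ι (κ (complexCoord e p 1, complexCoord e p 2))).1 ^ 2 -
        (ι (κ (complexCoord e p 1, complexCoord e p 2))).2 ^ 2 ∈ Complex.slitPlane
      rw [hι, hval, Complex.mem_slitPlane_iff]
      set z := (σ : ℂ) * complexCoord e p 0
      by_contra! h
      have him : z.im = 0 := by
        have := h.2
        simp only [sq, Complex.mul_im] at this
        nlinarith
      have := h.1
      simp only [sq, Complex.mul_re, him] at this
      nlinarith
    · change quadricGraph e σ μ ι (κ (complexCoord e p 1, complexCoord e p 2)) ∈ O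
      rwa [hψ]

variable {e}

theorem finrank_ker_complexForm {p : Bivector} (hp : complexForm e p p ≠ 0) :
    Module.finrank ℝ (complexForm e p).ker = 4 := by
  have hsurj : Function.Surjective (complexForm e p) := by
    intro c
    refine ⟨(complexCoord e).symm ((c / complexForm e p p) • complexCoord e p), ?_⟩
    rw [complexForm_apply]
    simp only [LinearEquiv.apply_symm_apply, Pi.smul_apply, smul_eq_mul]
    rw [show ∀ a x y z : ℂ, x * (a * x) + y * (a * y) + z * (a * z) =
      a * (x * x + y * y + z * z) from fun a x y z => by ring, ← complexForm_apply]
    exact div_mul_cancel₀ c hp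
  have h := (complexForm e p).finrank_range_add_finrank_ker
  rw [LinearMap.range_eq_top.mpr hsurj, finrank_top, Complex.finrank_real_complex,
    (complexCoord e).finrank_eq, Module.finrank_pi_fintype] at h
  simp only [Complex.finrank_real_complex, Finset.sum_const, Finset.card_univ, Fintype.card_fin,
    smul_eq_mul] at h
  omega

/-- The tangent spaces of a `4`-dimensional subset of a quadric `complexForm e p p = μ`. -/
theorem range_fderiv_eq_ker_complexForm {M : Set Bivector} {μ : ℂ} (hμ : μ ≠ 0)
    (hM : ∀ p ∈ M, complexForm e p p = μ) {U : Set (Fin 4 → ℝ)} {ψ : (Fin 4 → ℝ) → Bivector}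
    (h : IsLocalParam M U ψ) {u : Fin 4 → ℝ} (hu : u ∈ U) :
    (fderiv ℝ ψ u).range = (complexForm e (ψ u)).ker := by
  refine Submodule.eq_of_le_of_finrank_eq ?_ ?_
  · rintro _ ⟨w, rfl⟩
    have hd := ((h.contDiffAt hu).differentiableAt (by simp)).hasFDerivAt
    have h1 := HasFDerivAt.bilinear (complexForm e) hd hd w
    have h2 : (fun y => complexForm e (ψ y) (ψ y)) =ᶠ[𝓝 u] fun _ => μ := by
      filter_upwards [h.isOpen.mem_nhds hu] with y hy using hM _ (h.mem hy)
    rw [h2.fderiv_eq, complexForm_comm e _ (ψ u), ← two_mul] at h1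
    simpa using h1.symm
  · rw [finrank_ker_complexForm (by rw [hM _ (h.mem hu)]; exact hμ)]
    have := LinearMap.finrank_range_of_inj (f := (fderiv ℝ ψ u).toLinearMap) (h.immersion u hu)
    rw [Module.finrank_fin_fun] at this
    exact this

/-- The metric is non-degenerate on the complex orthogonal complement of a non-isotropic `p`: a
vector `v` there is paired non-trivially with the projection of its complex conjugate. -/
theorem eq_zero_of_forall_bivectorMetric_eq_zero (he : IsOrientedPseudoOrthonormal e)
    {p v : Bivector} (hp : complexForm e p p ≠ 0) (hv : complexForm e p v = 0)
    (h : ∀ w, complexForm e p w = 0 → bivectorMetric w v = 0) : v = 0 := by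
  set a := complexCoord e p with ha
  set z := complexCoord e v with hz
  set μ := complexForm e p p with hμ
  rw [complexForm_apply] at hμ hv
  rw [← ha] at hμ hv
  rw [← hz] at hv
  set c : ℂ := (a 0 * star (z 0) + a 1 * star (z 1) + a 2 * star (z 2)) / μ with hc
  have hcμ : c * μ = a 0 * star (z 0) + a 1 * star (z 1) + a 2 * star (z 2) :=
    div_mul_cancel₀ _ hp
  have h1 := h ((complexCoord e).symm ![star (z 0) - c * a 0, star (z 1) - c * a 1,
    star (z 2) - c * a 2]) (by
      rw [complexForm_apply, ← ha]
      simp only [LinearEquiv.apply_symm_apply, Matrix.cons_val_zero, Matrix.cons_val_one,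
        Matrix.cons_val]
      linear_combination -hcμ + c * hμ)
  rw [bivectorMetric_eq_re he, complexForm_apply, ← hz] at h1
  simp only [LinearEquiv.apply_symm_apply, Matrix.cons_val_zero, Matrix.cons_val_one,
    Matrix.cons_val] at h1
  rw [show (star (z 0) - c * a 0) * z 0 + (star (z 1) - c * a 1) * z 1 +
    (star (z 2) - c * a 2) * z 2 = star (z 0) * z 0 + star (z 1) * z 1 + star (z 2) * z 2 by
      linear_combination -c * hv] at h1
  have h2 : ∀ i, z i = 0 := by
    simp only [Complex.star_def, ← Complex.normSq_eq_conj_mul_self, Complex.add_re,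
      Complex.ofReal_re] at h1
    have n0 := Complex.normSq_nonneg (z 0)
    have n1 := Complex.normSq_nonneg (z 1)
    have n2 := Complex.normSq_nonneg (z 2)
    intro i
    rw [← Complex.normSq_eq_zero]
    fin_cases i <;> simp <;> rw [← Complex.normSq_eq_zero] <;> linarith
  apply (complexCoord e).injective
  rw [map_zero]
  exact funext h2

end Quadric

/-! ### The surface and the parallel fields -/

section Surface

variable {e : Module.Basis (Fin 4) ℝ E41}

theorem complexCoord_Omega (φ : ℝ) (i : Fin 3) : complexCoord e (Omega e φ) i =
    ![√2 * (Real.cos φ + Complex.I), 0, √2 * Real.sin φ] i := by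
  fin_cases i <;> apply Complex.ext <;>
    simp [complexCoord_zero, complexCoord_one, complexCoord_two, Omega, pluecker_wedge,
      -Complex.ofReal_cos, -Complex.ofReal_sin]

theorem complexForm_Omega (φ : ℝ) :
    complexForm e (Omega e φ) (Omega e φ) = 4 * Real.cos φ * Complex.I := by
  have h2 : (√2 : ℂ) ^ 2 = 2 := by
    rw [← Complex.ofReal_pow, Real.sq_sqrt (by norm_num)]
    norm_num
  have h3 : (Real.cos φ : ℂ) ^ 2 + (Real.sin φ : ℂ) ^ 2 = 1 := by
    exact_mod_cast Real.cos_sq_add_sin_sq φ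
  simp only [complexForm_apply, complexCoord_Omega, Matrix.cons_val_zero, Matrix.cons_val_one,
    Matrix.cons_val]
  linear_combination (Real.cos φ ^ 2 + 2 * Real.cos φ * Complex.I + Complex.I ^ 2 +
    Real.sin φ ^ 2) * h2 + 2 * h3 + 2 * Complex.I_sq

theorem P21_mem_SO31 (he : IsOrientedPseudoOrthonormal e) (θ : ℝ) : P21 e θ ∈ SO31 := by
  refine toLin_mem_SO31 he ?_ ?_
  · ext i j
    fin_cases i <;> fin_cases j <;>
      simp [minkowskiMatrix, Matrix.mul_apply, Fin.sum_univ_four, Matrix.diagonal] <;>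
      nlinarith [Real.sin_sq_add_cos_sq θ]
  · simp [Matrix.det_succ_row_zero, Fin.sum_univ_succ, Fin.succAbove]
    nlinarith [Real.sin_sq_add_cos_sq θ]

theorem P22_mem_SO31 (he : IsOrientedPseudoOrthonormal e) (t : ℝ) : P22 e t ∈ SO31 := by
  refine toLin_mem_SO31 he ?_ ?_
  · ext i j
    fin_cases i <;> fin_cases j <;>
      simp [minkowskiMatrix, Matrix.mul_apply, Fin.sum_univ_four, Matrix.diagonal] <;>
      nlinarith [Real.cosh_sq t]
  · simp [Matrix.det_succ_row_zero, Fin.sum_univ_succ, Fin.succAbove]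
    nlinarith [Real.cosh_sq t]

theorem T2_apply (θ t : ℝ) (p : Bivector) : T2 e θ t p = bivectorMap (P21 e θ ∘ₗ P22 e t) p :=
  (bivectorMap_comp _ _ p).symm

theorem P21_comp_P22_mem_SO31 (he : IsOrientedPseudoOrthonormal e) (θ t : ℝ) :
    P21 e θ ∘ₗ P22 e t ∈ SO31 :=
  comp_mem_SO31 (P21_mem_SO31 he θ) (P22_mem_SO31 he t)

/-- The rotation by `θ` and the boost by `t` act together on `ℂ³` as the rotation by the complex
angle `θ - i t` about the axis `z₁`. -/
theorem complexCoord_T2 (θ t : ℝ) (p : Bivector) (i : Fin 3) : complexCoord e (T2 e θ t p) i =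
    ![Complex.cos (θ - t * Complex.I) * complexCoord e p 0 +
        Complex.sin (θ - t * Complex.I) * complexCoord e p 2,
      complexCoord e p 1,
      -Complex.sin (θ - t * Complex.I) * complexCoord e p 0 +
        Complex.cos (θ - t * Complex.I) * complexCoord e p 2] i := by
  have h1 : ∀ (θ : ℝ) p i, complexCoord e (bivectorMap (P21 e θ) p) i =
      ![Real.cos θ * complexCoord e p 0 + Real.sin θ * complexCoord e p 2, complexCoord e p 1,
        -Real.sin θ * complexCoord e p 0 + Real.cos θ * complexCoord e p 2] i := by
    intro θ p i
    have hs : Real.cos θ * Real.cos θ = 1 - Real.sin θ * Real.sin θ := by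
      nlinarith [Real.sin_sq_add_cos_sq θ]
    fin_cases i <;> apply Complex.ext <;>
      simp [complexCoord_zero, complexCoord_one, complexCoord_two, P21, pluecker_bivectorMap,
        -Complex.ofReal_cos, -Complex.ofReal_sin, hs]
  have h2 : ∀ (t : ℝ) p i, complexCoord e (bivectorMap (P22 e t) p) i =
      ![Real.cosh t * complexCoord e p 0 - Complex.I * Real.sinh t * complexCoord e p 2,
        complexCoord e p 1,
        Complex.I * Real.sinh t * complexCoord e p 0 + Real.cosh t * complexCoord e p 2] i := by
    intro t p i
    have hs : Real.cosh t * Real.cosh t = 1 + Real.sinh t * Real.sinh t := by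
      nlinarith [Real.cosh_sq t]
    fin_cases i <;> apply Complex.ext <;>
      simp [complexCoord_zero, complexCoord_one, complexCoord_two, P22, pluecker_bivectorMap,
        -Complex.ofReal_cosh, -Complex.ofReal_sinh, hs] <;> ring
  rw [T2, LinearMap.comp_apply, h1, Complex.cos_sub, Complex.sin_sub, Complex.cos_mul_I,
    Complex.sin_mul_I]
  fin_cases i <;> simp [h2] <;> ring

theorem exists_cos_sin_eq {c s : ℂ} (h : c ^ 2 + s ^ 2 = 1) :
    ∃ θ t : ℝ, Complex.cos (θ - t * Complex.I) = c ∧ Complex.sin (θ - t * Complex.I) = s := by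
  suffices ∃ ζ : ℂ, Complex.cos ζ = c ∧ Complex.sin ζ = s by
    obtain ⟨ζ, h1, h2⟩ := this
    refine ⟨ζ.re, -ζ.im, ?_⟩
    have : (ζ.re : ℂ) - (-ζ.im : ℝ) * Complex.I = ζ := by
      push_cast
      rw [neg_mul, sub_neg_eq_add, Complex.re_add_im]
    rw [this]
    exact ⟨h1, h2⟩
  obtain ⟨ζ, hζ⟩ := Complex.cos_surjective c
  have h1 := Complex.sin_sq_add_cos_sq ζ
  rw [hζ] at h1
  have h2 : Complex.sin ζ ^ 2 = s ^ 2 := by linear_combination h1 - h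
  rcases sq_eq_sq_iff_eq_or_eq_neg.mp h2 with h3 | h3
  · exact ⟨ζ, hζ, h3⟩
  · exact ⟨-ζ, by rw [Complex.cos_neg, hζ], by rw [Complex.sin_neg, h3, neg_neg]⟩

/-- The surface is the complex conic in which the plane `z₁ = 0` meets the quadric. -/
theorem mem_surfaceS_iff (he : IsOrientedPseudoOrthonormal e) {φ : ℝ} (hφ : Real.cos φ ≠ 0)
    {p : Bivector} : p ∈ surfaceS e φ ↔ complexCoord e p 1 = 0 ∧
      complexForm e p p = complexForm e (Omega e φ) (Omega e φ) := by
  constructor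
  · rintro ⟨θ, t, rfl⟩
    refine ⟨by simp [complexCoord_T2, complexCoord_Omega], ?_⟩
    rw [T2_apply, complexForm_bivectorMap he (P21_comp_P22_mem_SO31 he θ t)]
  · rintro ⟨h1, hq⟩
    set a := complexCoord e (Omega e φ) 0 with ha
    set b := complexCoord e (Omega e φ) 2 with hb
    have hb1 : complexCoord e (Omega e φ) 1 = 0 := by simp [complexCoord_Omega]
    have hμ : complexForm e (Omega e φ) (Omega e φ) ≠ 0 := by
      rw [complexForm_Omega]
      simp only [ne_eq, mul_eq_zero, Complex.I_ne_zero, Complex.ofReal_eq_zero, hφ]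
      norm_num
    rw [complexForm_apply, complexForm_apply, hb1, h1, ← ha, ← hb] at hq
    rw [complexForm_apply, hb1, ← ha, ← hb] at hμ
    set z := complexCoord e p 0 with hz
    set w := complexCoord e p 2 with hw
    have hμ' : a ^ 2 + b ^ 2 ≠ 0 := by
      intro h
      apply hμ
      linear_combination h
    obtain ⟨θ, t, hc, hs⟩ := exists_cos_sin_eq (c := (a * z + b * w) / (a ^ 2 + b ^ 2))
      (s := (b * z - a * w) / (a ^ 2 + b ^ 2)) (by
        field_simp
        linear_combination (a ^ 2 + b ^ 2) * hq)
    refine ⟨θ, t, (complexCoord e).injective (funext fun i => ?_)⟩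
    rw [complexCoord_T2, hc, hs, ← ha, ← hb, hb1]
    fin_cases i
    · simp only [Fin.zero_eta, Matrix.cons_val_zero, ← hz]
      field_simp
      ring
    · simpa using h1
    · simp only [Fin.reduceFinMk, Matrix.cons_val, ← hw]
      field_simp
      ring

theorem surfaceS_subset_so31Orbit (he : IsOrientedPseudoOrthonormal e) (φ : ℝ) :
    surfaceS e φ ⊆ so31Orbit (Omega e φ) := by
  rintro _ ⟨θ, t, rfl⟩
  exact ⟨_, P21_comp_P22_mem_SO31 he θ t, T2_apply θ t _⟩

theorem complexForm_Omega_im_ne_zero {φ : ℝ} (hφ : Real.cos φ ≠ 0) :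
    (complexForm e (Omega e φ) (Omega e φ)).im ≠ 0 := by
  rw [complexForm_Omega]
  simp only [Complex.mul_im, Complex.mul_re, Complex.I_re, Complex.I_im, Complex.ofReal_re,
    Complex.ofReal_im, Complex.re_ofNat, Complex.im_ofNat]
  simpa using hφ

theorem complexForm_Omega_ne_zero {φ : ℝ} (hφ : Real.cos φ ≠ 0) :
    complexForm e (Omega e φ) (Omega e φ) ≠ 0 := fun h =>
  complexForm_Omega_im_ne_zero (e := e) hφ (by rw [h, Complex.zero_im])

/-- The identification of `ℝ⁴` with `ℂ²`. -/
noncomputable def realToComplexPair : (Fin 4 → ℝ) ≃ₗ[ℝ] ℂ × ℂ where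
  toFun u := (⟨u 0, u 1⟩, ⟨u 2, u 3⟩)
  map_add' u v := by
    refine Prod.ext ?_ ?_ <;> apply Complex.ext <;> simp
  map_smul' c u := by
    refine Prod.ext ?_ ?_ <;> apply Complex.ext <;> simp
  invFun w := ![w.1.re, w.1.im, w.2.re, w.2.im]
  left_inv u := by
    ext i
    fin_cases i <;> rfl
  right_inv w := rfl

/-- The embedding of `ℝ²` as the complex line `{0} × ℂ`. -/
noncomputable def realToComplexLine : (Fin 2 → ℝ) →ₗ[ℝ] ℂ × ℂ where
  toFun u := (0, ⟨u 0, u 1⟩)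
  map_add' u v := by
    refine Prod.ext ?_ ?_ <;> apply Complex.ext <;> simp
  map_smul' c u := by
    refine Prod.ext ?_ ?_ <;> apply Complex.ext <;> simp

/-- The projection to the second complex coordinate, inverse to `realToComplexLine`. -/
noncomputable def complexPairToReal : ℂ × ℂ →ₗ[ℝ] (Fin 2 → ℝ) where
  toFun w := ![w.2.re, w.2.im]
  map_add' u v := by
    ext i
    fin_cases i <;> simp
  map_smul' c u := by
    ext i
    fin_cases i <;> simp

theorem exists_sign {c : ℝ} (hc : c ≠ 0) : ∃ σ : ℝ, σ * σ = 1 ∧ 0 < σ * c := by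
  rcases lt_or_gt_of_ne hc with h | h
  · exact ⟨-1, by norm_num, by linarith⟩
  · exact ⟨1, by norm_num, by linarith⟩

theorem sign_mul_re_Omega_pos {φ σ : ℝ} (hσ : 0 < σ * Real.cos φ) :
    0 < σ * (complexCoord e (Omega e φ) 0).re := by
  have h : (complexCoord e (Omega e φ) 0).re = √2 * Real.cos φ := by
    simp [complexCoord_zero, Omega, pluecker_wedge]
  rw [h]
  have : 0 < √2 := by positivity
  nlinarith

theorem isOpen_sign_mul_re_pos (σ : ℝ) : IsOpen {p | 0 < σ * (complexCoord e p 0).re} :=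
  isOpen_lt continuous_const
    (continuous_const.mul (Complex.continuous_re.comp (continuous_complexCoord e 0)))

theorem isSubmanifold_so31Orbit (he : IsOrientedPseudoOrthonormal e) {φ : ℝ}
    (hφ : Real.cos φ ≠ 0) : IsSubmanifold 4 (so31Orbit (Omega e φ)) := by
  obtain ⟨σ, hσ, hσφ⟩ := exists_sign hφ
  set Ω := Omega e φ with hΩ
  set O : Set Bivector := {p | 0 < σ * (complexCoord e p 0).re} ∩
    {p | complexForm e (p + Ω) (p + Ω) ≠ 0} with hO
  have hcont : Continuous fun p => complexForm e (p + Ω) (p + Ω) := by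
    simp only [complexForm_apply]
    simp only [map_add, Pi.add_apply]
    have := continuous_complexCoord e
    fun_prop
  have hOo : IsOpen O := (isOpen_sign_mul_re_pos σ).inter (isOpen_ne.preimage hcont)
  obtain ⟨hparam, himage⟩ := isLocalParam_quadricGraph e hσ (μ := complexForm e Ω Ω)
    (ι := realToComplexPair.toLinearMap) (κ := realToComplexPair.symm.toLinearMap)
    (fun u => realToComplexPair.symm_apply_apply u) (M := so31Orbit Ω) hOo (fun p hp => hp.1)
    (fun p hp => ⟨fun h => ⟨complexForm_of_mem_so31Orbit he h,
      realToComplexPair.apply_symm_apply _⟩, fun h =>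
      mem_so31Orbit_of_complexForm_eq he h.1 (complexForm_Omega_im_ne_zero hφ) hp.2⟩)
  have hΩM : Ω ∈ so31Orbit Ω :=
    ⟨LinearMap.id, ⟨fun _ _ => rfl, LinearMap.det_id⟩,
      (LinearMap.congr_fun exteriorPower.map_id Ω).symm⟩
  have hΩO : Ω ∈ O := by
    refine ⟨sign_mul_re_Omega_pos hσφ, ?_⟩
    have h := complexForm_Omega_ne_zero (e := e) hφ
    intro h0
    simp only [map_add, LinearMap.add_apply] at h0
    apply h
    linear_combination h0 / 4
  refine IsSubmanifold.of_homogeneous hparam (p₀ := Ω) ?_ ?_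
  · rw [himage]
    exact ⟨hΩM, hΩO⟩
  · rintro p ⟨P, hP, rfl⟩
    obtain ⟨A, hA⟩ := exists_equiv_eq_bivectorMap hP
    exact ⟨A, fun q => by rw [hA]; exact bivectorMap_mem_so31Orbit_iff hP, hA Ω⟩

theorem isSubmanifold_surfaceS (he : IsOrientedPseudoOrthonormal e) {φ : ℝ}
    (hφ : Real.cos φ ≠ 0) : IsSubmanifold 2 (surfaceS e φ) := by
  obtain ⟨σ, hσ, hσφ⟩ := exists_sign hφ
  obtain ⟨hparam, himage⟩ := isLocalParam_quadricGraph e hσ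
    (μ := complexForm e (Omega e φ) (Omega e φ)) (ι := realToComplexLine) (κ := complexPairToReal)
    (fun u => by
      ext i
      fin_cases i <;> rfl)
    (M := surfaceS e φ) (isOpen_sign_mul_re_pos σ) (fun p hp => hp)
    (fun p _ => by
      rw [mem_surfaceS_iff he hφ, and_comm]
      exact and_congr_right fun _ => ⟨fun h => Prod.ext h.symm rfl,
        fun h => (congrArg Prod.fst h).symm⟩)
  have hΩS : Omega e φ ∈ surfaceS e φ :=
    (mem_surfaceS_iff he hφ).mpr ⟨by simp [complexCoord_Omega], rfl⟩
  refine IsSubmanifold.of_homogeneous hparam (p₀ := Omega e φ) ?_ ?_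
  · rw [himage]
    exact ⟨hΩS, sign_mul_re_Omega_pos hσφ⟩
  · rintro p ⟨θ, t, rfl⟩
    have hP := P21_comp_P22_mem_SO31 he θ t
    obtain ⟨A, hA⟩ := exists_equiv_eq_bivectorMap hP
    refine ⟨A, fun q => ?_, by rw [hA, T2_apply]⟩
    rw [mem_surfaceS_iff he hφ, mem_surfaceS_iff he hφ, hA, complexForm_bivectorMap he hP,
      ← T2_apply, complexCoord_T2]
    rfl

/-- The complex multiple by `κ` of the quarter turn of `ℂ³` about the axis `z₁`. -/
noncomputable def quarterTurn (e : Module.Basis (Fin 4) ℝ E41) (κ : ℂ) :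
    Bivector →ₗ[ℝ] Bivector where
  toFun p := (complexCoord e).symm ![κ * complexCoord e p 2, 0, -(κ * complexCoord e p 0)]
  map_add' p q := by
    rw [← map_add]
    congr 1
    ext1 i
    fin_cases i <;> simp <;> ring
  map_smul' c p := by
    rw [RingHom.id_apply, ← map_smul]
    congr 1
    ext1 i
    fin_cases i <;> simp <;> ring

theorem complexForm_quarterTurn (κ : ℂ) (p q : Bivector) :
    complexForm e (quarterTurn e κ p) q =
      κ * (complexCoord e p 2 * complexCoord e q 0 - complexCoord e p 0 * complexCoord e q 2) := by
  simp [complexForm_apply, quarterTurn]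
  ring

/-- A smooth curve in the surface has velocities in the plane `z₁ = 0` which are orthogonal to
its position with respect to the complex form. -/
theorem deriv_curve_in_surfaceS (he : IsOrientedPseudoOrthonormal e) {φ : ℝ}
    (hφ : Real.cos φ ≠ 0) {γ : ℝ → Bivector} {s : ℝ} (hγ : IsCurveIn (surfaceS e φ) γ s) :
    complexCoord e (deriv γ s) 1 = 0 ∧ complexForm e (γ s) (deriv γ s) = 0 := by
  have hd : DifferentiableAt ℝ γ s := hγ.1.differentiableAt (by simp)
  constructor
  · have h1 := ((LinearMap.toContinuousLinearMap ((LinearMap.proj 1 : (Fin 3 → ℂ) →ₗ[ℝ] ℂ) ∘ₗ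
      (complexCoord e).toLinearMap)).hasFDerivAt (x := γ s)).comp_hasDerivAt s hd.hasDerivAt
    have h2 : (fun r => complexCoord e (γ r) 1) =ᶠ[𝓝 s] fun _ => 0 := by
      filter_upwards [hγ.2] with r hr using ((mem_surfaceS_iff he hφ).mp hr).1
    have h3 : deriv (fun r => complexCoord e (γ r) 1) s = 0 := by rw [h2.deriv_eq, deriv_const]
    exact h1.deriv.symm.trans h3
  · have h1 := HasFDerivAt.bilinear (complexForm e) hd.hasFDerivAt hd.hasFDerivAt 1
    have h2 : (fun r => complexForm e (γ r) (γ r)) =ᶠ[𝓝 s]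
        fun _ => complexForm e (Omega e φ) (Omega e φ) := by
      filter_upwards [hγ.2] with r hr using ((mem_surfaceS_iff he hφ).mp hr).2
    rw [h2.fderiv_eq, complexForm_comm e _ (γ s), ← two_mul] at h1
    simpa using h1.symm

/-- The tangent plane of the surface at `p` is the complex line spanned by `quarterTurn e 1 p`. -/
theorem tangentVectors_surfaceS (he : IsOrientedPseudoOrthonormal e) {φ : ℝ}
    (hφ : Real.cos φ ≠ 0) {p : Bivector} (hp : p ∈ surfaceS e φ) :
    tangentVectors (surfaceS e φ) p = {v | ∃ κ : ℂ, v = quarterTurn e κ p} := by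
  obtain ⟨h1, hq⟩ := (mem_surfaceS_iff he hφ).mp hp
  have hμ := complexForm_Omega_ne_zero (e := e) hφ
  rw [← hq, complexForm_apply, h1] at hμ
  ext v
  constructor
  · rintro ⟨γ, hγ, rfl, rfl⟩
    obtain ⟨hd1, hd2⟩ := deriv_curve_in_surfaceS he hφ hγ
    rw [complexForm_apply, h1] at hd2
    set z := complexCoord e (γ 0) with hz
    set d := complexCoord e (deriv γ 0) with hd
    have hμ' : z 0 * z 0 + z 2 * z 2 ≠ 0 := by simpa using hμ
    refine ⟨(z 2 * d 0 - z 0 * d 2) / (z 0 * z 0 + z 2 * z 2), ?_⟩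
    rw [quarterTurn, LinearMap.coe_mk, AddHom.coe_mk, LinearEquiv.eq_symm_apply, ← hz, ← hd]
    ext1 i
    fin_cases i
    · simp only [Fin.zero_eta, Matrix.cons_val_zero]
      rw [div_mul_eq_mul_div, eq_div_iff hμ']
      linear_combination z 0 * hd2
    · simpa using hd1
    · simp only [Fin.reduceFinMk, Matrix.cons_val]
      rw [div_mul_eq_mul_div, ← neg_div, eq_div_iff hμ']
      linear_combination z 2 * hd2
  · rintro ⟨κ, rfl⟩
    -- The curve is the orbit of `p` under the complex rotations by the angles `r κ`.
    set c : ℝ → Fin 3 → ℂ := fun r =>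
      ![Complex.cos (r * κ) * complexCoord e p 0 + Complex.sin (r * κ) * complexCoord e p 2, 0,
        -Complex.sin (r * κ) * complexCoord e p 0 + Complex.cos (r * κ) * complexCoord e p 2]
      with hc
    have hlin : ContDiff ℝ ∞ fun r : ℝ => (r : ℂ) * κ :=
      Complex.ofRealCLM.contDiff.mul contDiff_const
    have hcos : ContDiff ℝ ∞ fun r : ℝ => Complex.cos (r * κ) :=
      (Complex.contDiff_cos.restrict_scalars ℝ).comp hlin
    have hsin : ContDiff ℝ ∞ fun r : ℝ => Complex.sin (r * κ) :=
      (Complex.contDiff_sin.restrict_scalars ℝ).comp hlin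
    have hcs : ContDiff ℝ ∞ c := by
      rw [contDiff_pi]
      intro i
      fin_cases i
      · exact (hcos.mul contDiff_const).add (hsin.mul contDiff_const)
      · exact contDiff_const
      · exact (hsin.neg.mul contDiff_const).add (hcos.mul contDiff_const)
    have hl : HasDerivAt (fun z : ℂ => z * κ) κ ((0 : ℝ) : ℂ) := hasDerivAt_mul_const κ
    have hcd : HasDerivAt c
        ![κ * complexCoord e p 2, 0, -(κ * complexCoord e p 0)] 0 := by
      have hcos' : HasDerivAt (fun r : ℝ => Complex.cos (r * κ)) 0 0 := by
        simpa using hl.ccos.comp_ofReal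
      have hsin' : HasDerivAt (fun r : ℝ => Complex.sin (r * κ)) κ 0 := by
        simpa using hl.csin.comp_ofReal
      rw [hasDerivAt_pi]
      intro i
      fin_cases i
      · exact ((hcos'.mul_const (complexCoord e p 0)).add
          (hsin'.mul_const (complexCoord e p 2))).congr_deriv (by simp)
      · exact hasDerivAt_const _ _
      · exact ((hsin'.neg.mul_const (complexCoord e p 0)).add
          (hcos'.mul_const (complexCoord e p 2))).congr_deriv (by simp)
    set L := LinearMap.toContinuousLinearMap (complexCoord e).symm.toLinearMap with hL
    refine ⟨fun r => L (c r), ⟨(L.contDiff.comp hcs).contDiffAt, .of_forall fun r => ?_⟩, ?_, ?_⟩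
    · refine (mem_surfaceS_iff he hφ).mpr ⟨by simp [hL, hc], ?_⟩
      rw [← hq, complexForm_apply, complexForm_apply, h1]
      simp only [hL, hc, LinearMap.coe_toContinuousLinearMap', LinearEquiv.coe_coe,
        LinearEquiv.apply_symm_apply, Matrix.cons_val_zero, Matrix.cons_val_one, Matrix.cons_val]
      linear_combination (complexCoord e p 0 ^ 2 + complexCoord e p 2 ^ 2) *
        Complex.sin_sq_add_cos_sq (r * κ)
    · apply (complexCoord e).injective
      ext1 i
      fin_cases i <;> simp [hL, hc, h1]
    · exact (L.hasFDerivAt.comp_hasDerivAt (0 : ℝ) hcd).deriv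

theorem isTimelikeSurface_surfaceS (he : IsOrientedPseudoOrthonormal e) {φ : ℝ}
    (hφ : Real.cos φ ≠ 0) : IsTimelikeSurface bivectorMetric (surfaceS e φ) := by
  refine ⟨isSubmanifold_surfaceS he hφ, fun p hp => ?_⟩
  have hq := (mem_surfaceS_iff he hφ).mp hp
  have hμ := complexForm_Omega_ne_zero (e := e) hφ
  rw [← hq.2] at hμ
  set μ := complexForm e p p with hμ'
  -- A vector `κ τ` of the tangent plane has the square `Re (κ² μ)`, so that the frame consists of
  -- the multiples with `κ² = 1 / μ` and `κ² = -1 / μ`.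
  obtain ⟨κ, hκ⟩ := IsAlgClosed.exists_pow_nat_eq μ⁻¹ (n := 2) (by norm_num)
  have hκμ : κ ^ 2 * μ = 1 := by rw [hκ, inv_mul_cancel₀ hμ]
  have hκ0 : κ ≠ 0 := by
    rintro rfl
    simp at hκμ
  have hmetric : ∀ a b : ℂ,
      bivectorMetric (quarterTurn e a p) (quarterTurn e b p) = (a * b * μ).re := by
    intro a b
    rw [bivectorMetric_eq_re he, complexForm_quarterTurn]
    congr 1
    rw [hμ', complexForm_apply, hq.1]
    simp [quarterTurn]
    ring
  refine ⟨quarterTurn e κ p, quarterTurn e (Complex.I * κ) p, ?_, ?_, ?_, ?_⟩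
  · rw [tangentVectors_surfaceS he hφ hp]
    have hadd : ∀ (a b : ℝ), a • quarterTurn e κ p + b • quarterTurn e (Complex.I * κ) p =
        quarterTurn e ((a + b * Complex.I) * κ) p := by
      intro a b
      apply (complexCoord e).injective
      ext1 i
      fin_cases i <;> simp [quarterTurn] <;> ring
    ext v
    simp only [Set.mem_ofPred_eq, SetLike.mem_coe, Submodule.mem_span_pair, hadd]
    constructor
    · rintro ⟨c, rfl⟩
      exact ⟨(c / κ).re, (c / κ).im, by rw [Complex.re_add_im, div_mul_cancel₀ c hκ0]⟩
    · rintro ⟨a, b, rfl⟩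
      exact ⟨_, rfl⟩
  · rw [hmetric, ← sq, hκμ, Complex.one_re]
  · rw [hmetric, show Complex.I * κ * (Complex.I * κ) * μ = Complex.I ^ 2 * (κ ^ 2 * μ) by ring,
      hκμ, Complex.I_sq]
    simp
  · rw [hmetric, show κ * (Complex.I * κ) * μ = Complex.I * (κ ^ 2 * μ) by ring, hκμ]
    simp

theorem isPseudoRiemannianSubmanifold_so31Orbit (he : IsOrientedPseudoOrthonormal e) {φ : ℝ}
    (hφ : Real.cos φ ≠ 0) :
    IsPseudoRiemannianSubmanifold bivectorMetric 4 (so31Orbit (Omega e φ)) := by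
  refine ⟨isSubmanifold_so31Orbit he hφ, fun U ψ h u hu => ?_⟩
  have hM : ∀ p ∈ so31Orbit (Omega e φ), complexForm e p p = _ :=
    fun p => complexForm_of_mem_so31Orbit he
  have hμ := complexForm_Omega_ne_zero (e := e) hφ
  refine h.isUnit_det_inducedMetric hu (range_fderiv_eq_ker_complexForm hμ hM h hu) ?_
  intro v hv hw
  exact eq_zero_of_forall_bivectorMetric_eq_zero he (by rw [hM _ (h.mem hu)]; exact hμ) hv hw

/-- The extrinsic criterion for parallel fields, for the orbit and the surface. -/
theorem isParallelAlong_of_deriv (he : IsOrientedPseudoOrthonormal e) {φ : ℝ}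
    (hφ : Real.cos φ ≠ 0) {X : Bivector → Bivector} (hX : Differentiable ℝ X)
    (htan : ∀ p ∈ surfaceS e φ, complexForm e p (X p) = 0)
    (hperp : ∀ p ∈ surfaceS e φ, ∀ v w, complexCoord e v 1 = 0 → complexForm e p v = 0 →
      complexForm e p w = 0 → bivectorMetric (fderiv ℝ X p v) w = 0) :
    IsParallelAlong bivectorMetric 4 (so31Orbit (Omega e φ)) (surfaceS e φ) X := by
  intro γ s hγ
  have hd : DifferentiableAt ℝ γ s := hγ.1.differentiableAt (by simp)
  have hM : ∀ p ∈ so31Orbit (Omega e φ), complexForm e p p = _ :=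
    fun p => complexForm_of_mem_so31Orbit he
  refine hasCovDerivAlong_zero (T := fun p => (complexForm e p).ker)
    (fun v w => by rw [bivectorMetric_eq_re he, bivectorMetric_eq_re he, complexForm_comm])
    (isPseudoRiemannianSubmanifold_so31Orbit he hφ)
    (fun U ψ h u hu => range_fderiv_eq_ker_complexForm (complexForm_Omega_ne_zero hφ) hM h hu)
    ⟨hγ.1, hγ.2.mono fun r hr => surfaceS_subset_so31Orbit he φ hr⟩ ((hX _).comp s hd)
    (hγ.2.mono fun r hr => htan _ hr) fun w hw => ?_
  have hder : deriv (fun r => X (γ r)) s = fderiv ℝ X (γ s) (deriv γ s) :=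
    ((hX _).hasFDerivAt.comp_hasDerivAt s hd.hasDerivAt).deriv
  obtain ⟨h1, h2⟩ := deriv_curve_in_surfaceS he hφ hγ
  rw [hder]
  exact hperp _ hγ.2.self_of_nhds _ _ h1 h2 hw

/-- The quarter turn rotates `p` into the tangent plane of the surface and a tangent vector of the
surface into the complex line through `p`, which is normal to the orbit. -/
theorem isParallelAlong_quarterTurn (he : IsOrientedPseudoOrthonormal e) {φ : ℝ}
    (hφ : Real.cos φ ≠ 0) (κ : ℂ) :
    IsParallelAlong bivectorMetric 4 (so31Orbit (Omega e φ)) (surfaceS e φ)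
      (quarterTurn e κ) := by
  refine isParallelAlong_of_deriv he hφ
    (LinearMap.toContinuousLinearMap (quarterTurn e κ)).differentiable (fun p _ => ?_) ?_
  · rw [complexForm_comm, complexForm_quarterTurn]
    ring
  · intro p hp v w _ hv hw
    have hμ := complexForm_Omega_ne_zero (e := e) hφ
    obtain ⟨h1, hq⟩ := (mem_surfaceS_iff he hφ).mp hp
    rw [← hq, complexForm_apply, h1] at hμ
    rw [complexForm_apply, h1] at hv hw
    have hderiv : fderiv ℝ (quarterTurn e κ) p v = quarterTurn e κ v := by
      rw [show fderiv ℝ (quarterTurn e κ) p = LinearMap.toContinuousLinearMap (quarterTurn e κ)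
        from (LinearMap.toContinuousLinearMap (quarterTurn e κ)).fderiv]
      rfl
    rw [hderiv, bivectorMetric_eq_re he, complexForm_quarterTurn]
    have h0 : complexCoord e v 2 * complexCoord e w 0 -
        complexCoord e v 0 * complexCoord e w 2 = 0 := by
      refine (mul_eq_zero.mp ?_).resolve_left hμ
      linear_combination
        (complexCoord e p 2 * complexCoord e w 0 - complexCoord e p 0 * complexCoord e w 2) * hv +
          (complexCoord e p 0 * complexCoord e v 2 - complexCoord e p 2 * complexCoord e v 0) * hw
    rw [h0, mul_zero, Complex.zero_re]

theorem isParallelAlong_const (he : IsOrientedPseudoOrthonormal e) {φ : ℝ}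
    (hφ : Real.cos φ ≠ 0) {v : Bivector} (h0 : complexCoord e v 0 = 0)
    (h2 : complexCoord e v 2 = 0) :
    IsParallelAlong bivectorMetric 4 (so31Orbit (Omega e φ)) (surfaceS e φ) fun _ => v := by
  refine isParallelAlong_of_deriv he hφ (differentiable_const v) (fun p hp => ?_) ?_
  · rw [complexForm_apply, h0, h2, ((mem_surfaceS_iff he hφ).mp hp).1]
    ring
  · intro p _ u w _ _ _
    simp

theorem quarterTurn_T2_Omega {φ ε : ℝ} (hε : ε = 1 ∨ ε = -1) (θ t : ℝ) :
    quarterTurn e ((1 + ε * Complex.I) / 2) (T2 e θ t (Omega e φ)) = T2 e θ t (Xvec e φ ε) := by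
  have hX : ∀ i, complexCoord e (Xvec e φ ε) i =
      ![(1 + ε * Complex.I) / √2 * Real.sin φ, 0,
        -((1 + ε * Complex.I) / √2 * (Real.cos φ + Complex.I))] i := by
    intro i
    rcases hε with rfl | rfl <;> fin_cases i <;> apply Complex.ext <;>
      simp [complexCoord_zero, complexCoord_one, complexCoord_two, Xvec, E1, E3,
        pluecker_wedge, -Complex.ofReal_cos, -Complex.ofReal_sin] <;> ring
  have h2 : (√2 : ℂ) ^ 2 = 2 := by
    rw [← Complex.ofReal_pow, Real.sq_sqrt (by norm_num)]
    norm_num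
  have h0 : (√2 : ℂ) ≠ 0 := by
    intro h
    rw [h] at h2
    norm_num at h2
  apply (complexCoord e).injective
  ext1 i
  rw [quarterTurn, LinearMap.coe_mk, AddHom.coe_mk, LinearEquiv.apply_symm_apply]
  fin_cases i <;> simp [complexCoord_T2, hX, complexCoord_Omega] <;> field_simp <;>
    rw [h2] <;> ring

theorem T2_Yvec (ε θ t : ℝ) : T2 e θ t (Yvec e ε) = Yvec e ε := by
  apply (complexCoord e).injective
  ext1 i
  rw [complexCoord_T2]
  fin_cases i <;>
    simp [complexCoord_zero, complexCoord_one, complexCoord_two, Yvec, E2, pluecker_wedge,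
      show (⟨0, 0⟩ : ℂ) = 0 from rfl]

theorem complexCoord_Yvec (ε : ℝ) : complexCoord e (Yvec e ε) 0 = 0 ∧
    complexCoord e (Yvec e ε) 2 = 0 := by
  constructor <;> apply Complex.ext <;>
    simp [complexCoord_zero, complexCoord_two, Yvec, E2, pluecker_wedge]

end Surface

theorem mainTheorem8 (e : Module.Basis (Fin 4) ℝ E41) (he : IsOrientedPseudoOrthonormal e)
    (φ : ℝ) (hφ : φ ∈ Set.Icc 0 Real.pi) (hφ' : φ ≠ Real.pi / 2) :
    IsPseudoRiemannianSubmanifold bivectorMetric 4 (so31Orbit (Omega e φ)) ∧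
    surfaceS e φ ⊆ so31Orbit (Omega e φ) ∧
    IsTimelikeSurface bivectorMetric (surfaceS e φ) ∧
    ∀ ε : ℝ, ε = 1 ∨ ε = -1 →
      (∃ X : Bivector → Bivector,
        (∀ θ t : ℝ, X (T2 e θ t (Omega e φ)) = T2 e θ t (Xvec e φ ε)) ∧
        IsParallelAlong bivectorMetric 4 (so31Orbit (Omega e φ)) (surfaceS e φ) X) ∧
      (∃ Y : Bivector → Bivector,
        (∀ θ t : ℝ, Y (T2 e θ t (Omega e φ)) = T2 e θ t (Yvec e ε)) ∧
        IsParallelAlong bivectorMetric 4 (so31Orbit (Omega e φ)) (surfaceS e φ) Y) := by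
  have hcos : Real.cos φ ≠ 0 := fun h => hφ' (Real.injOn_cos hφ
    ⟨by positivity, by linarith [Real.pi_pos]⟩ (by rw [h, Real.cos_pi_div_two]))
  refine ⟨isPseudoRiemannianSubmanifold_so31Orbit he hcos, surfaceS_subset_so31Orbit he φ,
    isTimelikeSurface_surfaceS he hcos, fun ε hε => ⟨?_, ?_⟩⟩
  · exact ⟨_, quarterTurn_T2_Omega hε, isParallelAlong_quarterTurn he hcos _⟩
  · obtain ⟨h0, h2⟩ := complexCoord_Yvec (e := e) ε
    exact ⟨fun _ => Yvec e ε, fun θ t => (T2_Yvec ε θ t).symm,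
      isParallelAlong_const he hcos h0 h2⟩
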